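/- Let $(\xi_k)_{k\in\mathbb Z}$ be iid random vectors in $\mathbb R^m$ with $E\|\xi_1\|^4<\infty$, $E(\xi_1)=0$ and $\Sigma_\xi=E(\xi_1\xi_1^T)$, and let $\Sigma_\xi^{1/2}\in\mathbb R^{m\times m}$ be any matrix with $\Sigma_\xi=\Sigma_\xi^{1/2}(\Sigma_\xi^{1/2})^T$. Let $C_j\in\mathbb R^{m\times m}$, $j\ge 0$, satisfy $\sum_{j\ge0}j\|C_j\|^2<\infty$ and $\sum_{j\ge0}\|C_j\|<\infty$, where $\|\cdot\|$ is the operator norm for the Euclidean norm, and put $C_j=0$ for $j<0$. Let $$Y_k=\sum_{j=0}^\infty C_j\xi_{k-j}\quad\text{(a.s.)},\qquad k\in\mathbb Z,$$ and, for $h\in\mathbb N_0$ and $n>h$, let $\Gamma_Y(h)=E(Y_0Y_h^T)$ and $$\widehat\Gamma_n(h)=\frac1n\sum_{k=1}^{n-h}(Y_k-\overline Y_n)(Y_{k+h}-\overline Y_n)^T,\qquad \overline Y_n=\frac1n\sum_{k=1}^nY_k .$$ Let $\mathrm{vec}$ denote stacking of columns, $\otimes$ the Kronecker product, $e_i$ the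 standard basis vectors, $P_{m,m}=\sum_{i,j=1}^m e_ie_j^T\otimes e_je_i^T$ the Kronecker permutation matrix, $$\Upsilon^*=E\big((\xi_1\otimes\xi_1)(\xi_1\otimes\xi_1)^T\big)-E(\xi_1\otimes\xi_1)E(\xi_1\otimes\xi_1)^T,$$ $$\Sigma_r=\sum_{j=0}^\infty C_{j+r}\otimes C_j,\qquad \Sigma_r^*=\sum_{j=0}^\infty C_j\otimes C_{j+r}\qquad(r\in\mathbb Z).$$ Fix $h\in\mathbb N_0$. Then the series $\Sigma_r$ and $\Sigma^*_r$ converge for all $r\in\mathbb Z$, the expectations below exist, $$E(\mathrm{vec}(Y_0Y_h^T))=E(Y_h\otimes Y_0)=\Sigma_h\,\mathrm{vec}(\Sigma_\xi),$$ and, as $n\to\infty$, $$\sqrt n\,\mathrm{vec}\big(\widehat\Gamma_n(h)-\Gamma_Y(h)\big)\Longrightarrow\mathcal N(0_{m^2},V),$$ where the two series in $$\begin{aligned}V={}&\Sigma_h\Upsilon^*\Sigma_h^T+\sum_{r=1}^\infty\Big[\Sigma_{r+h}(\Sigma_\xi\otimes\Sigma_\xi)\Sigma_{r+h}^T+\S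igma^*_{r-h}(\Sigma_\xi\otimes\Sigma_\xi)\Sigma_{r-h}^{*\,T}\Big]\\&+\sum_{r=1}^\infty\Big[\Sigma_{r+h}(\Sigma_\xi^{1/2}\otimes\Sigma_\xi^{1/2})P_{m,m}(\Sigma_\xi^{1/2\,T}\otimes\Sigma_\xi^{1/2\,T})\Sigma_{r-h}^{*\,T}+\Sigma^*_{r-h}(\Sigma_\xi^{1/2}\otimes\Sigma_\xi^{1/2})P_{m,m}(\Sigma_\xi^{1/2\,T}\otimes\Sigma_\xi^{1/2\,T})\Sigma_{r+h}^T\Big]\end{aligned}$$ converge and $V$ is positive semidefinite. -/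

import Mathlib

open MeasureTheory ProbabilityTheory Filter Topology
open scoped Matrix Kronecker

namespace MovingAverage

noncomputable section

/-- The operator norm of a square matrix acting on Euclidean space. -/
def opNorm {m : ℕ} (A : Matrix (Fin m) (Fin m) ℝ) : ℝ :=
  ‖Matrix.toEuclideanCLM (n := Fin m) (𝕜 := ℝ) A‖

/-- The Kronecker product `x ⊗ y` of two column vectors. -/
def kronVec {ι κ : Type*} (x : ι → ℝ) (y : κ → ℝ) : ι × κ → ℝ := fun p => x p.1 * y p.2

/-- The Kronecker permutation matrix `∑ i j, (eᵢ eⱼᵀ) ⊗ (eⱼ eᵢᵀ)`. -/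
def kronPerm (m : ℕ) : Matrix (Fin m × Fin m) (Fin m × Fin m) ℝ :=
  ∑ i, ∑ j, Matrix.single i j (1 : ℝ) ⊗ₖ Matrix.single j i (1 : ℝ)

section moments

variable {Ω : Type*} [MeasurableSpace Ω]

/-- The matrix `E(X Zᵀ)` of mixed moments (entrywise expectation). -/
def mixedMoment {ι κ : Type*} (P : Measure Ω) (X : Ω → ι → ℝ) (Z : Ω → κ → ℝ) : Matrix ι κ ℝ :=
  Matrix.of fun i j => ∫ ω, X ω i * Z ω j ∂P

/-- `Y` is the moving average process `Y_k = ∑_{j ≥ 0} C_j ξ_{k-j}`, `k ∈ ℤ`: for each `k` the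
series converges almost surely to `Y_k`. -/
def IsMAProcess {m : ℕ} (P : Measure Ω) (C : ℤ → Matrix (Fin m) (Fin m) ℝ)
    (ξ Y : ℤ → Ω → EuclideanSpace ℝ (Fin m)) : Prop :=
  ∀ k : ℤ, ∀ᵐ ω ∂P,
    HasSum (fun j : ℕ => Matrix.toEuclideanCLM (n := Fin m) (𝕜 := ℝ) (C j) (ξ (k - j) ω)) (Y k ω)

/-- The autocovariance function `Γ_Y(h) = E(Y_0 Y_hᵀ)` of a centred process. -/
def autocov {m : ℕ} (P : Measure Ω) (Y : ℤ → Ω → EuclideanSpace ℝ (Fin m)) (h : ℤ) :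
    Matrix (Fin m) (Fin m) ℝ :=
  mixedMoment P (fun ω => (Y 0 ω).ofLp) (fun ω => (Y h ω).ofLp)

/-- The sample mean `n⁻¹ ∑_{k=1}^n Y_k`. -/
def sampleMean {m : ℕ} (Y : ℤ → Ω → EuclideanSpace ℝ (Fin m)) (n : ℕ) (ω : Ω) :
    EuclideanSpace ℝ (Fin m) :=
  (n : ℝ)⁻¹ • ∑ k ∈ Finset.Icc 1 n, Y k ω

/-- The sample autocovariance
`n⁻¹ ∑_{k=1}^{n-h} (Y_k - mean) (Y_{k+h} - mean)ᵀ`, for `0 ≤ h ≤ n - 1`. -/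
def sampleAutocov {m : ℕ} (Y : ℤ → Ω → EuclideanSpace ℝ (Fin m)) (n h : ℕ) (ω : Ω) :
    Matrix (Fin m) (Fin m) ℝ :=
  (n : ℝ)⁻¹ • ∑ k ∈ Finset.Icc 1 (n - h),
    Matrix.vecMulVec (Y k ω - sampleMean Y n ω).ofLp (Y (k + h) ω - sampleMean Y n ω).ofLp

/-- `Υ* = E((X ⊗ X)(X ⊗ X)ᵀ) - E(X ⊗ X) E(X ⊗ X)ᵀ` for a random vector `X`. -/
def upsilonStar {m : ℕ} (P : Measure Ω) (X : Ω → EuclideanSpace ℝ (Fin m)) :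
    Matrix (Fin m × Fin m) (Fin m × Fin m) ℝ :=
  mixedMoment P (fun ω => kronVec (X ω).ofLp (X ω).ofLp) (fun ω => kronVec (X ω).ofLp (X ω).ofLp)
    - Matrix.vecMulVec (fun p => ∫ ω, kronVec (X ω).ofLp (X ω).ofLp p ∂P)
        (fun p => ∫ ω, kronVec (X ω).ofLp (X ω).ofLp p ∂P)

end moments

section covariance

variable {m : ℕ} (C : ℤ → Matrix (Fin m) (Fin m) ℝ)

/-- `Σ_r = ∑_{j ≥ 0} C_{j+r} ⊗ C_j`. -/
def sigmaSum (r : ℤ) : Matrix (Fin m × Fin m) (Fin m × Fin m) ℝ :=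
  ∑' j : ℕ, C (j + r) ⊗ₖ C j

/-- `Σ*_r = ∑_{j ≥ 0} C_j ⊗ C_{j+r}`. -/
def sigmaStarSum (r : ℤ) : Matrix (Fin m × Fin m) (Fin m × Fin m) ℝ :=
  ∑' j : ℕ, C j ⊗ₖ C (j + r)

/-- `Σ_{r+h} (S ⊗ S) Σ_{r+h}ᵀ + Σ*_{r-h} (S ⊗ S) Σ*_{r-h}ᵀ`. -/
def diagTerm (S : Matrix (Fin m) (Fin m) ℝ) (h r : ℤ) :
    Matrix (Fin m × Fin m) (Fin m × Fin m) ℝ :=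
  sigmaSum C (r + h) * (S ⊗ₖ S) * (sigmaSum C (r + h))ᵀ
    + sigmaStarSum C (r - h) * (S ⊗ₖ S) * (sigmaStarSum C (r - h))ᵀ

/-- `Σ_{r+h} (A ⊗ A) P_{m,m} (Aᵀ ⊗ Aᵀ) Σ*_{r-h}ᵀ + Σ*_{r-h} (A ⊗ A) P_{m,m} (Aᵀ ⊗ Aᵀ) Σ_{r+h}ᵀ`. -/
def crossTerm (A : Matrix (Fin m) (Fin m) ℝ) (h r : ℤ) :
    Matrix (Fin m × Fin m) (Fin m × Fin m) ℝ :=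
  sigmaSum C (r + h) * (A ⊗ₖ A) * kronPerm m * (Aᵀ ⊗ₖ Aᵀ) * (sigmaStarSum C (r - h))ᵀ
    + sigmaStarSum C (r - h) * (A ⊗ₖ A) * kronPerm m * (Aᵀ ⊗ₖ Aᵀ) * (sigmaSum C (r + h))ᵀ

/-- The asymptotic covariance matrix, where `U` is the matrix `Υ*`, `S` the noise covariance and
`A` a root of it, `S = A Aᵀ`; both series run over `r ≥ 1`. -/
def limitCov (U : Matrix (Fin m × Fin m) (Fin m × Fin m) ℝ) (S A : Matrix (Fin m) (Fin m) ℝ)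
    (h : ℤ) : Matrix (Fin m × Fin m) (Fin m × Fin m) ℝ :=
  sigmaSum C h * U * (sigmaSum C h)ᵀ
    + ∑' r : ℕ, diagTerm C S h (r + 1)
    + ∑' r : ℕ, crossTerm C A h (r + 1)

end covariance

end

end MovingAverage

/-! By Lévy's continuity theorem it suffices to find, for each `t`, the limit of the characteristic
function at 1 of √n ⟨t, vec(Γ̂_n(h) − Γ_Y(h))⟩. This functional is 1-Lipschitz for the L¹ norm,
hence for the L² norm, so remainders that are small in either norm may be dropped.

Dropping the sample mean and extending the sum from n − h to n terms costs O(n^{-1/2}) in L¹,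
because sums of n terms of the linear process are O(√n) in L² (`exists_L1Bound_sampleAutocov`). What
remains is n^{-1/2} ∑_k of the centred ⟨t, Y_{k+h} ⊗ Y_k⟩, an absolutely convergent bilinear form in
the products ξ_{k-i} ⊗ ξ_{k-j}. Shift each product in time until the later of its two times is k.
For a fixed pair (i, j) this changes only boundary terms, an error O(n^{-1/2}), and dominated
convergence over the pairs needs no more than absolute summability (`tendsto_cfOne_bilinear`). Now
all pairs with the same difference δ = i − j share one product, with coefficient Σ_{δ+h}ᵀ t.

Centred products with different later times are orthogonal, so cutting down to finitely many δ is
harmless uniformly in n. The result is an orthogonal stationary sequence, each term a function of D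
+ 1 consecutive noise vectors. Blocks of length L separated by gaps of length D have iid sums, to
which the classical central limit theorem applies; the gaps carry a share D/(D+L) of the variance,
negligible for large L (`tendsto_cfOne_sum_of_finite_range`).

The limiting variance is the squared norm of the sum over δ of the lag-δ terms. Lags δ and δ' are
correlated only if δ' = ±δ: δ = 0 yields Υ*, equal nonzero lags yield Σ_ξ ⊗ Σ_ξ, and opposite lags,
where the two factors trade places, yield the terms with P_{m,m} (`norm_sq_limitLp`). So tᵀVt is a
squared norm, which also makes V positive semidefinite. -/

namespace MovingAverage

open scoped InnerProductSpace ENNReal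

/-! ### Characteristic functions under L² approximation -/

section CharFun

variable {Ω : Type*} [MeasurableSpace Ω] {P : Measure Ω}

/-- The characteristic function of a real random variable, evaluated at `1`. -/
noncomputable def cfOne (P : Measure Ω) (X : Ω → ℝ) : ℂ :=
  ∫ ω, Complex.exp (X ω * Complex.I) ∂P

lemma cfOne_congr {X X' : Ω → ℝ} (h : X =ᵐ[P] X') : cfOne P X = cfOne P X' :=
  integral_congr_ae (h.mono fun ω hω => by simp only [hω])

lemma cfOne_eq_charFun {X : Ω → ℝ} (hX : AEMeasurable X P) (t : ℝ) :
    cfOne P (fun ω => t * X ω) = charFun (P.map X) t := by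
  rw [charFun_apply_real, integral_map hX (by fun_prop)]
  simp [cfOne]

lemma norm_exp_mul_I_sub_le (x y : ℝ) :
    ‖Complex.exp (x * Complex.I) - Complex.exp (y * Complex.I)‖ ≤ |x - y| := by
  have h : Complex.exp (x * Complex.I) - Complex.exp (y * Complex.I)
      = Complex.exp (y * Complex.I) * (Complex.exp (Complex.I * ((x - y : ℝ) : ℂ)) - 1) := by
    rw [mul_sub, ← Complex.exp_add]
    congr 2
    · push_cast; ring
    · simp
  rw [h, norm_mul, Complex.norm_exp_ofReal_mul_I, one_mul]
  simpa using Real.norm_exp_I_mul_ofReal_sub_one_le (x := x - y)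

lemma integrable_exp_mul_I [IsFiniteMeasure P] {X : Ω → ℝ} (hX : AEMeasurable X P) :
    Integrable (fun ω => Complex.exp (X ω * Complex.I)) P := by
  refine Integrable.of_bound (C := 1) ?_ (Eventually.of_forall fun ω => ?_)
  · exact (Complex.measurable_exp.comp_aemeasurable
      ((Complex.measurable_ofReal.comp_aemeasurable hX).mul_const _)).aestronglyMeasurable
  · rw [Complex.norm_exp_ofReal_mul_I]

lemma norm_cfOne_sub_le [IsFiniteMeasure P] {X X' : Ω → ℝ} (hX : AEMeasurable X P)
    (hX' : AEMeasurable X' P) (hi : Integrable (fun ω => X ω - X' ω) P) :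
    ‖cfOne P X - cfOne P X'‖ ≤ ∫ ω, |X ω - X' ω| ∂P := by
  rw [cfOne, cfOne, ← integral_sub (integrable_exp_mul_I hX) (integrable_exp_mul_I hX')]
  exact norm_integral_le_of_norm_le hi.abs
    (Eventually.of_forall fun ω => norm_exp_mul_I_sub_le _ _)

lemma integral_abs_le_norm [IsProbabilityMeasure P] (f : Lp ℝ 2 P) : ∫ ω, |f ω| ∂P ≤ ‖f‖ := by
  have h1 := eLpNorm_le_eLpNorm_of_exponent_le (μ := P) (p := 1) (q := 2) (f := f) (by norm_num)
    (Lp.aestronglyMeasurable f)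
  have h2 : eLpNorm f 1 P = ENNReal.ofReal (∫ ω, |f ω| ∂P) := by
    rw [eLpNorm_one_eq_lintegral_enorm,
      ← ofReal_integral_norm_eq_lintegral_enorm ((Lp.memLp f).integrable (by norm_num))]
    rfl
  rw [Lp.norm_def]
  rw [h2] at h1
  exact (ENNReal.ofReal_le_iff_le_toReal (Lp.eLpNorm_ne_top f)).1 h1

/-- The map x ↦ exp(ix) is 1-Lipschitz, and on a probability space the L¹ norm is at most the L²
norm. This lets the whole limit argument be carried out with Hilbert space estimates. -/
lemma norm_cfOne_sub_le_norm [IsProbabilityMeasure P] (f g : Lp ℝ 2 P) :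
    ‖cfOne P f - cfOne P g‖ ≤ ‖f - g‖ := by
  have hi : (fun ω => f ω - g ω) =ᵐ[P] (f - g : Lp ℝ 2 P) := (Lp.coeFn_sub f g).symm
  refine (norm_cfOne_sub_le (Lp.aestronglyMeasurable f).aemeasurable
    (Lp.aestronglyMeasurable g).aemeasurable ?_).trans ?_
  · exact (((Lp.memLp (f - g)).integrable (by norm_num)).congr hi.symm)
  · refine le_of_eq_of_le (integral_congr_ae ?_) (integral_abs_le_norm (f - g))
    exact hi.mono fun ω hω => congrArg abs hω

/-- Asymptotic normality transfers through uniform approximation in `L²`. -/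
lemma tendsto_cfOne_of_approx [IsProbabilityMeasure P] {T : ℕ → Lp ℝ 2 P} {z : ℂ}
    (h : ∀ ε > 0, ∃ (T' : ℕ → Lp ℝ 2 P) (z' : ℂ), ‖z' - z‖ < ε ∧
      Tendsto (fun n => cfOne P (T' n)) atTop (𝓝 z') ∧ ∀ᶠ n in atTop, ‖T n - T' n‖ < ε) :
    Tendsto (fun n => cfOne P (T n)) atTop (𝓝 z) := by
  rw [Metric.tendsto_nhds]
  intro ε hε
  obtain ⟨T', z', h1, h2, h3⟩ := h (ε / 3) (by positivity)
  filter_upwards [h3, Metric.tendsto_nhds.1 h2 (ε / 3) (by positivity)] with n h4 h5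
  have h6 := norm_cfOne_sub_le_norm (T n) (T' n)
  rw [dist_eq_norm] at *
  calc ‖cfOne P (T n) - z‖
      = ‖(cfOne P (T n) - cfOne P (T' n)) + (cfOne P (T' n) - z') + (z' - z)‖ := by congr 1; ring
    _ ≤ ‖cfOne P (T n) - cfOne P (T' n)‖ + ‖cfOne P (T' n) - z'‖ + ‖z' - z‖ := norm_add₃_le
    _ < ε := by linarith

lemma tendsto_cfOne_of_norm_sub [IsProbabilityMeasure P] {T T' : ℕ → Lp ℝ 2 P} {z : ℂ}
    (h : Tendsto (fun n => ‖T n - T' n‖) atTop (𝓝 0))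
    (h' : Tendsto (fun n => cfOne P (T' n)) atTop (𝓝 z)) :
    Tendsto (fun n => cfOne P (T n)) atTop (𝓝 z) :=
  tendsto_cfOne_of_approx fun ε hε => ⟨T', z, by simpa using hε, h', h.eventually_lt_const hε⟩

end CharFun

/-! ### Series in L² and pointwise series -/

section Series

variable {Ω : Type*} [MeasurableSpace Ω] {P : Measure Ω}

lemma Lp_coeFn_sum {κ : Type*} (s : Finset κ) (f : κ → Lp ℝ 2 P) :
    ((∑ i ∈ s, f i : Lp ℝ 2 P) : Ω → ℝ) =ᵐ[P] fun ω => ∑ i ∈ s, f i ω := by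
  classical
  induction s using Finset.induction_on with
  | empty => simpa using! Lp.coeFn_zero ℝ 2 P
  | insert a s ha ih =>
    rw [Finset.sum_insert ha]
    filter_upwards [Lp.coeFn_add (f a) (∑ i ∈ s, f i), ih] with ω h1 h2
    rw [h1, Pi.add_apply, h2, Finset.sum_insert ha]

/-- The pointwise sum of a series that also converges in `L²` is the sum in `L²`. -/
lemma ae_eq_of_hasSum_Lp {κ : Type*} [Countable κ] {f : κ → Lp ℝ 2 P} {F : Lp ℝ 2 P}
    (hF : HasSum f F) {φ : κ → Ω → ℝ} (hφ : ∀ i, f i =ᵐ[P] φ i) {g : Ω → ℝ}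
    (hg : ∀ᵐ ω ∂P, HasSum (fun i => φ i ω) (g ω)) : F =ᵐ[P] g := by
  have h1 : TendstoInMeasure P (fun s : Finset κ => ((∑ i ∈ s, f i : Lp ℝ 2 P) : Ω → ℝ))
      atTop F := tendstoInMeasure_of_tendsto_Lp hF
  -- Convergence in measure gives a.e. convergence along a sequence `ns` of finite sets tending to
  -- `atTop`; the unconditional pointwise sum must have the same limit along it.
  obtain ⟨ns, hns, hae⟩ := h1.exists_seq_tendsto_ae'
  have h2 : ∀ᵐ ω ∂P, ∀ k, (∑ i ∈ ns k, f i : Lp ℝ 2 P) ω = ∑ i ∈ ns k, f i ω :=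
    ae_all_iff.2 fun k => Lp_coeFn_sum _ _
  filter_upwards [hae, h2, hg, ae_all_iff.2 hφ] with ω h3 h4 h5 h6
  simp only [h4, h6] at h3
  have h7 : Tendsto (fun s : Finset κ => ∑ i ∈ s, φ i ω) atTop (𝓝 (g ω)) := h5
  exact tendsto_nhds_unique h3 (h7.comp hns)

lemma tendsto_norm_tsum_of_dominated {κ E : Type*} [NormedAddCommGroup E] [CompleteSpace E]
    {f : ℕ → κ → E} {bd : κ → ℝ} (hbd : Summable bd) (h : ∀ n i, ‖f n i‖ ≤ bd i)
    (hlim : ∀ i, Tendsto (fun n => ‖f n i‖) atTop (𝓝 0)) :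
    Tendsto (fun n => ‖∑' i, f n i‖) atTop (𝓝 0) := by
  have := tendsto_tsum_of_dominated_convergence (f := f) (g := fun _ => (0 : E)) hbd
    (fun i => tendsto_zero_iff_norm_tendsto_zero.2 (hlim i)) (Eventually.of_forall h)
  simpa using this.norm

end Series

/-! ### Sums of orthogonal vectors -/

section Orthogonal

variable {κ H : Type*} [NormedAddCommGroup H] [InnerProductSpace ℝ H]

lemma norm_sq_sum_of_orthogonal {z : κ → H} (s : Finset κ)
    (h : ∀ i ∈ s, ∀ j ∈ s, i ≠ j → ⟪z i, z j⟫_ℝ = 0) :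
    ‖∑ i ∈ s, z i‖ ^ 2 = ∑ i ∈ s, ‖z i‖ ^ 2 := by
  classical
  rw [← real_inner_self_eq_norm_sq, sum_inner]
  refine Finset.sum_congr rfl fun i hi => ?_
  rw [inner_sum, Finset.sum_eq_single i (fun j hj hji => h i hi j hj hji.symm)
    (fun hn => absurd hi hn), real_inner_self_eq_norm_sq]

/-- Pythagoras: the growth is √card instead of card, exactly what the normalization by √n can
absorb. -/
lemma norm_sum_le_of_orthogonal {z : κ → H} {M : ℝ} (hM : 0 ≤ M) (s : Finset κ)
    (h : ∀ i ∈ s, ∀ j ∈ s, i ≠ j → ⟪z i, z j⟫_ℝ = 0) (hz : ∀ i ∈ s, ‖z i‖ ≤ M) :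
    ‖∑ i ∈ s, z i‖ ≤ M * √(s.card) := by
  rw [← abs_of_nonneg (norm_nonneg _)]
  refine abs_le_of_sq_le_sq ?_ (by positivity)
  rw [norm_sq_sum_of_orthogonal s h, mul_pow, Real.sq_sqrt (by positivity)]
  calc ∑ i ∈ s, ‖z i‖ ^ 2 ≤ ∑ i ∈ s, M ^ 2 :=
        Finset.sum_le_sum fun i hi => pow_le_pow_left₀ (norm_nonneg _) (hz i hi) 2
    _ = M ^ 2 * s.card := by simp [mul_comm]

end Orthogonal

/-! ### Independence of blocks -/

section Independence

variable {Ω : Type*} [MeasurableSpace Ω] {P : Measure Ω}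

open Measure in
/-- Independence is preserved by grouping an independent family into disjoint blocks. -/
lemma iIndepFun_curry {κ τ E : Type*} [MeasurableSpace E] {X : κ → τ → Ω → E}
    (hX : ∀ i j, Measurable (X i j)) (h : iIndepFun (fun (p : κ × τ) ω => X p.1 p.2 ω) P) :
    iIndepFun (fun i ω j => X i j ω) P := by
  have := h.isProbabilityMeasure
  have hs : iIndepFun (fun (p : (_ : κ) × τ) ω => X p.1 p.2 ω) P :=
    h.precomp (g := Equiv.sigmaEquivProd κ τ) (Equiv.sigmaEquivProd κ τ).injective
  have hp : ∀ i j, IsProbabilityMeasure (P.map (X i j)) :=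
    fun i j => isProbabilityMeasure_map (hX i j).aemeasurable
  have hrow : ∀ i, iIndepFun (X i) P := fun i =>
    h.precomp (g := fun j : τ => (i, j)) (fun a b hab => by simpa using hab)
  have hc : (MeasurableEquiv.piCurry fun (_ : κ) (_ : τ) => E) ∘
      (fun ω (p : (_ : κ) × τ) => X p.1 p.2 ω) = fun ω i j => X i j ω := by
    ext; simp [Sigma.curry]
  rw [iIndepFun_iff_map_fun_eq_infinitePi_map (by fun_prop)] at hs ⊢
  -- Independence means that the joint law is a product measure; currying the product over pairs
  -- gives an iterated product, whose factors are the laws of the rows.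
  rw [← hc, ← map_map (by fun_prop) (by fun_prop), hs,
    infinitePi_map_piCurry (fun i j => P.map (X i j))]
  congrm infinitePi fun i => ?_
  rw [(iIndepFun_iff_map_fun_eq_infinitePi_map (by fun_prop)).1 (hrow i)]

/-- Two families of independent variables with the same marginals have the same law. -/
lemma identDistrib_family {τ E : Type*} [MeasurableSpace E] {X X' : τ → Ω → E}
    (hX : ∀ j, Measurable (X j)) (hX' : ∀ j, Measurable (X' j)) (h : iIndepFun X P)
    (h' : iIndepFun X' P) (hid : ∀ j, IdentDistrib (X j) (X' j) P P) :
    IdentDistrib (fun ω j => X j ω) (fun ω j => X' j ω) P P := by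
  have := h.isProbabilityMeasure
  refine ⟨(measurable_pi_iff.2 hX).aemeasurable, (measurable_pi_iff.2 hX').aemeasurable, ?_⟩
  rw [(iIndepFun_iff_map_fun_eq_infinitePi_map hX).1 h,
    (iIndepFun_iff_map_fun_eq_infinitePi_map hX').1 h']
  congr 1
  ext1 j
  exact (hid j).map_eq

end Independence


/-! ### Central limit theorem for finite-range functionals, by blocks and gaps -/

section FiniteRange

variable {Ω : Type*} [MeasurableSpace Ω] {P : Measure Ω} [IsProbabilityMeasure P]

lemma integral_sq_eq_norm_sq (f : Lp ℝ 2 P) : ∫ ω, f ω ^ 2 ∂P = ‖f‖ ^ 2 := by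
  rw [← real_inner_self_eq_norm_sq, L2.inner_def]
  exact integral_congr_ae (Eventually.of_forall fun ω => by simp [pow_two])

/-- The central limit theorem for iid square integrable centred variables, in terms of
characteristic functions. -/
lemma tendsto_cfOne_sum_of_iid {X : ℕ → Ω → ℝ} (hind : iIndepFun X P)
    (hid : ∀ i, IdentDistrib (X i) (X 0) P P) {V : ℕ → Lp ℝ 2 P} (hV : ∀ i, V i =ᵐ[P] X i)
    (hmean : ∫ ω, V 0 ω ∂P = 0) (c : ℝ) :
    Tendsto (fun N : ℕ => cfOne P ((c • ((√(N : ℝ))⁻¹ • ∑ u ∈ Finset.range N, V u) : Lp ℝ 2 P)))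
      atTop (𝓝 (Complex.exp (-((c ^ 2 * ‖V 0‖ ^ 2 / 2 : ℝ) : ℂ)))) := by
  have hX0 : MemLp (X 0) 2 P := (Lp.memLp (V 0)).ae_eq (hV 0)
  have hm : ∫ ω, X 0 ω ∂P = 0 := by rw [← integral_congr_ae (hV 0), hmean]
  have hvar : Var[X 0; P] = ‖V 0‖ ^ 2 := by
    rw [variance_eq_integral hX0.aestronglyMeasurable.aemeasurable, hm, ← integral_sq_eq_norm_sq]
    exact integral_congr_ae ((hV 0).mono fun ω hω => by simp [hω])
  have hclt := tendstoInDistribution_inv_sqrt_mul_sum_sub (P := P) (X := X)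
    (Y := (id : ℝ → ℝ)) (P' := gaussianReal 0 Var[X 0; P].toNNReal) ⟨by fun_prop, by simp⟩
    hX0 hind hid
  have h1 := ProbabilityMeasure.tendsto_iff_tendsto_charFun.1 hclt.tendsto c
  simp only [ProbabilityMeasure.coe_mk, Measure.map_id, charFun_gaussianReal] at h1
  have h2 : ((Var[X 0; P].toNNReal : ℝ) : ℂ) = ((‖V 0‖ ^ 2 : ℝ) : ℂ) := by
    rw [Real.coe_toNNReal _ (variance_nonneg _ _), hvar]
  rw [h2] at h1
  convert h1 using 2
  · rename_i N
    rw [← cfOne_eq_charFun (hclt.forall_aemeasurable N)]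
    refine cfOne_congr ?_
    filter_upwards [Lp.coeFn_smul c ((√(N : ℝ))⁻¹ • ∑ u ∈ Finset.range N, V u),
      Lp.coeFn_smul ((√(N : ℝ))⁻¹) (∑ u ∈ Finset.range N, V u),
      Lp_coeFn_sum (Finset.range N) V, ae_all_iff.2 hV] with ω h3 h4 h5 h6
    rw [h3, Pi.smul_apply, h4, Pi.smul_apply, h5]
    simp [h6, hm]
  · congr 1
    push_cast
    ring

variable {E : Type*} [MeasurableSpace E] {x : ℤ → Ω → E}

/-- The vectors of consecutive observations over disjoint blocks of length `K` are iid. -/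
lemma iid_blocks (hx : ∀ k, Measurable (x k)) (hind : iIndepFun x P)
    (hid : ∀ k l, IdentDistrib (x k) (x l) P P) (K : ℕ) :
    iIndepFun (fun (u : ℕ) ω (j : Fin K) => x ((u * K + j : ℕ) + 1) ω) P ∧
    ∀ u : ℕ, IdentDistrib (fun ω (j : Fin K) => x ((u * K + j : ℕ) + 1) ω)
      (fun ω (j : Fin K) => x (((0 : ℕ) * K + j : ℕ) + 1) ω) P P := by
  have hrow : ∀ u : ℕ, iIndepFun (fun (j : Fin K) => x ((u * K + j : ℕ) + 1)) P := fun u =>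
    hind.precomp (g := fun j : Fin K => (((u * K + j : ℕ) : ℤ) + 1)) fun a b hab => by
      ext; simpa using hab
  refine ⟨?_, fun u => identDistrib_family (fun _ => hx _) (fun _ => hx _) (hrow u) (hrow 0)
    fun j => hid _ _⟩
  refine iIndepFun_curry (X := fun (u : ℕ) (j : Fin K) => x ((u * K + j : ℕ) + 1))
    (fun _ _ => hx _) ?_
  refine hind.precomp (g := fun p : ℕ × Fin K => (((p.1 * K + p.2 : ℕ) : ℤ) + 1)) ?_
  rintro ⟨u, j⟩ ⟨u', j'⟩ h
  simp only [add_left_inj, Nat.cast_inj] at h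
  -- The place `j` inside a block shows that blocks are nonempty; division by `K` then recovers the
  -- block number.
  have hK : 0 < K := j.pos
  have h1 : u = u' := by
    have := congrArg (· / K) h
    simpa [Nat.add_div_of_dvd_right, Nat.mul_add_div, mul_comm _ K, hK,
      Nat.div_eq_of_lt j.isLt, Nat.div_eq_of_lt j'.isLt] using this
  subst h1
  ext
  · rfl
  · simpa using h

variable {D : ℕ} {G : (Fin (D + 1) → E) → ℝ} {Z : ℤ → Lp ℝ 2 P} {σ : ℝ}

/-- Sum over the last `L` times of a block of length `D + L`. -/
noncomputable def blockSum (Z : ℤ → Lp ℝ 2 P) (D L u : ℕ) : Lp ℝ 2 P :=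
  ∑ l ∈ Finset.range L, Z ((u * (D + L) + (D + l) : ℕ) + 1)

lemma norm_sq_blockSum (horth : ∀ k l, k ≠ l → ⟪Z k, Z l⟫_ℝ = 0) (hnorm : ∀ k, ‖Z k‖ = σ)
    (L u : ℕ) : ‖blockSum Z D L u‖ ^ 2 = L * σ ^ 2 := by
  rw [blockSum, norm_sq_sum_of_orthogonal]
  · simp [hnorm]
  · intro i _ j _ hij
    exact horth _ _ (by simpa using hij)

/-- Skipping the first `D` places of a block keeps the `D` steps of memory of each summand inside
that block, so the block sums are one function `Ψ` of disjoint stretches of noise and hence iid. -/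
lemma tendsto_cfOne_blockSum (hx : ∀ k, Measurable (x k)) (hind : iIndepFun x P)
    (hid : ∀ k l, IdentDistrib (x k) (x l) P P) (hG : Measurable G)
    (hZ : ∀ k, Z k =ᵐ[P] fun ω => G fun l => x (k - (l : ℕ)) ω)
    (horth : ∀ k l, k ≠ l → ⟪Z k, Z l⟫_ℝ = 0) (hnorm : ∀ k, ‖Z k‖ = σ)
    (hmean : ∀ k, ∫ ω, Z k ω ∂P = 0) (L : ℕ) (c : ℝ) :
    Tendsto (fun N : ℕ => cfOne P
        ((c • ((√(N : ℝ))⁻¹ • ∑ u ∈ Finset.range N, blockSum Z D L u) : Lp ℝ 2 P)))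
      atTop (𝓝 (Complex.exp (-((c ^ 2 * (L * σ ^ 2) / 2 : ℝ) : ℂ)))) := by
  -- The natural number subtraction `D + l - l'` is never truncated, since `l' ≤ D`.
  set Ψ : (Fin (D + L) → E) → ℝ := fun b =>
    ∑ l : Fin L, G fun l' => b ⟨D + l - l', by omega⟩ with hΨ
  have hΨm : Measurable Ψ := by
    refine Finset.measurable_sum _ fun l _ => hG.comp ?_
    exact measurable_pi_iff.2 fun l' => measurable_pi_apply _
  obtain ⟨h1, h2⟩ := iid_blocks hx hind hid (D + L)
  have h3 : ∀ u, blockSum Z D L u =ᵐ[P]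
      fun ω => Ψ fun j : Fin (D + L) => x ((u * (D + L) + j : ℕ) + 1) ω := by
    intro u
    filter_upwards [Lp_coeFn_sum (Finset.range L)
      fun l : ℕ => Z ((u * (D + L) + (D + l) : ℕ) + 1), ae_all_iff.2 hZ] with ω h4 h5
    rw [blockSum, h4, hΨ, Finset.sum_range]
    refine Finset.sum_congr rfl fun l _ => ?_
    rw [h5]
    congr 1
    ext1 l'
    congr 1
    have hl' : (l' : ℕ) ≤ D := by omega
    push_cast [Nat.cast_sub (show (l' : ℕ) ≤ D + l by omega)]
    ring
  have h6 := tendsto_cfOne_sum_of_iid (h1.comp (fun _ => Ψ) fun _ => hΨm)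
    (fun u => (h2 u).comp hΨm) (V := blockSum Z D L) h3 ?_ c
  · rwa [norm_sq_blockSum horth hnorm] at h6
  · rw [blockSum, integral_congr_ae (Lp_coeFn_sum _ _), integral_finsetSum]
    · exact Finset.sum_eq_zero fun l _ => hmean _
    · exact fun l _ => (Lp.memLp _).integrable (by norm_num)

/-- The times belonging to the last `L` places of the blocks of length `D + L`. -/
def blockTimes (D L N : ℕ) : Finset ℕ :=
  (Finset.range N ×ˢ Finset.range L).image fun p => p.1 * (D + L) + (D + p.2)

lemma blockTimes_injOn (D L N : ℕ) :
    Set.InjOn (fun p : ℕ × ℕ => p.1 * (D + L) + (D + p.2))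
      (Finset.range N ×ˢ Finset.range L : Finset (ℕ × ℕ)) := by
  rintro ⟨u, l⟩ h ⟨u', l'⟩ h' hab
  simp only [Finset.coe_product, Finset.coe_range, Set.mem_prod, Set.mem_Iio] at h h' hab
  have h1 : u = u' := by
    rcases lt_trichotomy u u' with hlt | heq | hlt
    · nlinarith
    · exact heq
    · nlinarith
  subst h1
  ext
  · rfl
  · simpa using hab

lemma card_blockTimes (D L N : ℕ) : (blockTimes D L N).card = N * L := by
  rw [blockTimes, Finset.card_image_of_injOn (blockTimes_injOn D L N)]
  simp

lemma sum_blockTimes (Z : ℤ → Lp ℝ 2 P) (D L N : ℕ) :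
    ∑ k ∈ blockTimes D L N, Z (k + 1) = ∑ u ∈ Finset.range N, blockSum Z D L u := by
  rw [blockTimes, Finset.sum_image (blockTimes_injOn D L N), Finset.sum_product]
  rfl

lemma blockTimes_subset {D L n N : ℕ} (h : N * (D + L) ≤ n) :
    blockTimes D L N ⊆ Finset.range n := by
  intro k hk
  simp only [blockTimes, Finset.mem_image, Finset.mem_product, Finset.mem_range] at hk
  obtain ⟨⟨u, l⟩, ⟨hu, hl⟩, rfl⟩ := hk
  rw [Finset.mem_range]
  simp only at *
  nlinarith

/-- The first `n` times split into the `N * L` block times, where only the scalars `c` and `d`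
differ, and the other `n - N * L` times, which occur in the first sum only. Orthogonality bounds
each part. -/
lemma norm_sub_blockSum_le (hσ : 0 ≤ σ) (horth : ∀ k l, k ≠ l → ⟪Z k, Z l⟫_ℝ = 0)
    (hnorm : ∀ k, ‖Z k‖ = σ) {L n N : ℕ} (h : N * (D + L) ≤ n) (c d : ℝ) :
    ‖c • ∑ k ∈ Finset.range n, Z (k + 1) - d • ∑ u ∈ Finset.range N, blockSum Z D L u‖
      ≤ |c - d| * (σ * √(N * L : ℕ)) + |c| * (σ * √(n - N * L : ℕ)) := by
  have horth' : ∀ s : Finset ℕ, ∀ i ∈ s, ∀ j ∈ s, i ≠ j → ⟪Z (i + 1), Z (j + 1)⟫_ℝ = 0 :=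
    fun s i _ j _ hij => horth _ _ (by simpa using hij)
  have h1 := Finset.sum_sdiff (f := fun k : ℕ => Z (k + 1)) (blockTimes_subset h)
  have h2 : (Finset.range n \ blockTimes D L N).card = n - N * L := by
    rw [Finset.card_sdiff_of_subset (blockTimes_subset h), card_blockTimes, Finset.card_range]
  have h3 := norm_sum_le_of_orthogonal hσ (blockTimes D L N) (horth' _)
    (fun i _ => (hnorm _).le)
  have h4 := norm_sum_le_of_orthogonal hσ (Finset.range n \ blockTimes D L N) (horth' _)
    (fun i _ => (hnorm _).le)
  rw [card_blockTimes] at h3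
  rw [h2] at h4
  rw [← h1, ← sum_blockTimes, smul_add, add_sub_assoc, ← sub_smul, add_comm]
  refine (norm_add_le _ _).trans ?_
  rw [norm_smul, norm_smul, Real.norm_eq_abs, Real.norm_eq_abs]
  gcongr

lemma tendsto_natCast_div_div (K : ℕ) (hK : 0 < K) :
    Tendsto (fun n : ℕ => ((n / K : ℕ) : ℝ) / n) atTop (𝓝 ((K : ℝ)⁻¹)) := by
  have h := (tendsto_nat_floor_mul_div_atTop (R := ℝ) (a := (K : ℝ)⁻¹) (by positivity)).comp
    tendsto_natCast_atTop_atTop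
  refine h.congr fun n => ?_
  simp only [Function.comp]
  rw [inv_mul_eq_div, Nat.floor_div_natCast, Nat.floor_natCast]

/-- **Central limit theorem** for orthogonal, stationary functionals of finitely many consecutive
terms of an iid sequence. -/
theorem tendsto_cfOne_sum_of_finite_range (hx : ∀ k, Measurable (x k)) (hind : iIndepFun x P)
    (hid : ∀ k l, IdentDistrib (x k) (x l) P P) (hG : Measurable G)
    (hZ : ∀ k, Z k =ᵐ[P] fun ω => G fun l => x (k - (l : ℕ)) ω)
    (horth : ∀ k l, k ≠ l → ⟪Z k, Z l⟫_ℝ = 0) (hnorm : ∀ k, ‖Z k‖ = σ)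
    (hmean : ∀ k, ∫ ω, Z k ω ∂P = 0) :
    Tendsto (fun n : ℕ => cfOne P
        (((√(n : ℝ))⁻¹ • ∑ k ∈ Finset.range n, Z (k + 1)) : Lp ℝ 2 P))
      atTop (𝓝 (Complex.exp (-((σ ^ 2 / 2 : ℝ) : ℂ)))) := by
  have hσ : 0 ≤ σ := hnorm 0 ▸ norm_nonneg _
  have hfrac : Tendsto (fun L : ℕ => (L : ℝ) / (D + L)) atTop (𝓝 1) := by
    have := tendsto_natCast_div_add_atTop (D : ℝ)
    simpa [add_comm] using this
  refine tendsto_cfOne_of_approx fun ε hε => ?_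
  have hl1 : Tendsto (fun L : ℕ => Complex.exp (-((((L : ℝ) / (D + L)) * σ ^ 2 / 2 : ℝ) : ℂ)))
      atTop (𝓝 (Complex.exp (-((1 * σ ^ 2 / 2 : ℝ) : ℂ)))) := by
    refine (Complex.continuous_exp.tendsto _).comp (Tendsto.neg ?_)
    exact (Complex.continuous_ofReal.tendsto _).comp ((hfrac.mul_const _).div_const _)
  have hl2 : Tendsto (fun L : ℕ => σ * √(1 - (L : ℝ) / (D + L))) atTop (𝓝 0) := by
    have := ((Real.continuous_sqrt.tendsto _).comp (hfrac.const_sub 1)).const_mul σ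
    simpa using this
  rw [one_mul] at hl1
  -- `L` is chosen so large that the gaps change neither the variance (`hl1`) nor the sum in L²
  -- (`hl2`) by much; `L ≥ 1` makes the block length positive.
  obtain ⟨L, hL1, hL2, hL3⟩ := ((Metric.tendsto_nhds.1 hl1 ε hε).and
    ((hl2.eventually_lt_const hε).and (eventually_ge_atTop 1))).exists
  set K := D + L with hK
  have hK0 : 0 < K := by omega
  have hKr : ((K : ℕ) : ℝ) = D + L := by simp [hK]
  have hKpos : (0 : ℝ) < K := by exact_mod_cast hK0
  -- With N = ⌊n/K⌋ complete blocks, (KN)^{-1/2} is asymptotic to n^{-1/2}; this is where the factor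
  -- `c` in the block limit comes from.
  refine ⟨fun n => (√(K : ℝ))⁻¹ • ((√((n / K : ℕ) : ℝ))⁻¹ •
    ∑ u ∈ Finset.range (n / K), blockSum Z D L u), _, by rwa [dist_eq_norm] at hL1, ?_, ?_⟩
  · have h1 := (tendsto_cfOne_blockSum hx hind hid hG hZ horth hnorm hmean L (√(K : ℝ))⁻¹).comp
      (Nat.tendsto_div_const_atTop hK0.ne')
    have h2 : (√(K : ℝ))⁻¹ ^ 2 * (L * σ ^ 2) / 2 = (L : ℝ) / (D + L) * σ ^ 2 / 2 := by
      rw [inv_pow, Real.sq_sqrt hKpos.le, hKr]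
      ring
    rwa [h2] at h1
  · have hb : ∀ᶠ n : ℕ in atTop, ‖(√(n : ℝ))⁻¹ • ∑ k ∈ Finset.range n, Z (k + 1) -
        (√(K : ℝ))⁻¹ • ((√((n / K : ℕ) : ℝ))⁻¹ •
          ∑ u ∈ Finset.range (n / K), blockSum Z D L u)‖ ≤
        |√(((n / K : ℕ) : ℝ) / n) - (√(K : ℝ))⁻¹| * (σ * √L)
          + σ * √(1 - L * (((n / K : ℕ) : ℝ) / n)) := by
      filter_upwards [eventually_ge_atTop K] with n hn
      have hNK : n / K * K ≤ n := Nat.div_mul_le_self n K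
      have hN0 : 0 < n / K := Nat.div_pos hn hK0
      have hn0 : (0 : ℝ) < n := by exact_mod_cast hK0.trans_le hn
      have hNr : (0 : ℝ) < (n / K : ℕ) := by exact_mod_cast hN0
      rw [smul_smul]
      refine (norm_sub_blockSum_le hσ horth hnorm hNK _ _).trans (le_of_eq ?_)
      have hsub : ((n - n / K * L : ℕ) : ℝ) = n * (1 - L * (((n / K : ℕ) : ℝ) / n)) := by
        rw [Nat.cast_sub ((Nat.mul_le_mul_left _ (by omega)).trans hNK)]
        push_cast
        field_simp
      rw [hsub, Real.sqrt_mul hn0.le, abs_of_pos (inv_pos.2 (Real.sqrt_pos.2 hn0))]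
      congr 1
      · rw [Nat.cast_mul, Real.sqrt_mul hNr.le, Real.sqrt_div hNr.le]
        have h5 : √(((n / K : ℕ) : ℝ)) / √(n : ℝ) - (√(K : ℝ))⁻¹
            = ((√(n : ℝ))⁻¹ - (√(K : ℝ))⁻¹ * (√((n / K : ℕ) : ℝ))⁻¹) * √((n / K : ℕ) : ℝ) := by
          have := (Real.sqrt_pos.2 hNr).ne'
          field_simp
        rw [h5, abs_mul, abs_of_nonneg (Real.sqrt_nonneg ((n / K : ℕ) : ℝ))]
        ring
      · have := (Real.sqrt_pos.2 hn0).ne'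
        field_simp
    have hNn := tendsto_natCast_div_div K hK0
    have hlim : Tendsto (fun n : ℕ => |√(((n / K : ℕ) : ℝ) / n) - (√(K : ℝ))⁻¹| * (σ * √L)
          + σ * √(1 - L * (((n / K : ℕ) : ℝ) / n))) atTop
        (𝓝 (|√((K : ℝ)⁻¹) - (√(K : ℝ))⁻¹| * (σ * √L) + σ * √(1 - L * (K : ℝ)⁻¹))) := by
      refine Tendsto.add (Tendsto.mul_const _ (Tendsto.abs (Tendsto.sub_const ?_ _)))
        (Tendsto.const_mul _ ?_)
      · exact (Real.continuous_sqrt.tendsto _).comp hNn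
      · exact (Real.continuous_sqrt.tendsto _).comp ((hNn.const_mul _).const_sub 1)
    have hlt : |√((K : ℝ)⁻¹) - (√(K : ℝ))⁻¹| * (σ * √L) + σ * √(1 - L * (K : ℝ)⁻¹) < ε := by
      rw [Real.sqrt_inv, sub_self, abs_zero, zero_mul, zero_add, hKr, ← div_eq_mul_inv]
      exact hL2
    filter_upwards [hb, hlim.eventually_lt_const hlt] with n h1 h2
    exact h1.trans_lt h2

end FiniteRange


/-! ### Centring as a bounded operator on L² -/

section Centre

variable {Ω : Type*} [MeasurableSpace Ω] {P : Measure Ω} [IsProbabilityMeasure P]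

/-- Subtraction of the expectation, as an operator on `L²`. -/
noncomputable def centre (P : Measure Ω) [IsProbabilityMeasure P] : Lp ℝ 2 P →L[ℝ] Lp ℝ 2 P :=
  ContinuousLinearMap.id ℝ _ - (innerSL ℝ (Lp.const 2 P (1 : ℝ))).smulRight (Lp.const 2 P (1 : ℝ))

lemma inner_const_one (f : Lp ℝ 2 P) : ⟪Lp.const 2 P (1 : ℝ), f⟫_ℝ = ∫ ω, f ω ∂P := by
  rw [L2.inner_def]
  refine integral_congr_ae ?_
  filter_upwards [Lp.coeFn_const (p := 2) (μ := P) (c := (1 : ℝ))] with ω h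
  simp

lemma centre_apply (f : Lp ℝ 2 P) :
    centre P f = f - (∫ ω, f ω ∂P) • Lp.const 2 P (1 : ℝ) := by
  simp [centre, inner_const_one]

lemma centre_coeFn (f : Lp ℝ 2 P) : centre P f =ᵐ[P] fun ω => f ω - ∫ ω, f ω ∂P := by
  rw [centre_apply]
  filter_upwards [Lp.coeFn_const (p := 2) (μ := P) (c := (1 : ℝ)),
    Lp.coeFn_sub f ((∫ ω, f ω ∂P) • Lp.const 2 P (1 : ℝ)),
    Lp.coeFn_smul (∫ ω, f ω ∂P) (Lp.const 2 P (1 : ℝ))] with ω h1 h2 h3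
  rw [h2, Pi.sub_apply, h3, Pi.smul_apply, h1]
  simp

lemma integral_centre (f : Lp ℝ 2 P) : ∫ ω, centre P f ω ∂P = 0 := by
  rw [integral_congr_ae (centre_coeFn f),
    integral_sub ((Lp.memLp f).integrable (by norm_num)) (integrable_const _)]
  simp

lemma inner_centre (f g : Lp ℝ 2 P) :
    ⟪centre P f, centre P g⟫_ℝ = ⟪f, g⟫_ℝ - (∫ ω, f ω ∂P) * ∫ ω, g ω ∂P := by
  have h : ⟪centre P f, Lp.const 2 P (1 : ℝ)⟫_ℝ = 0 := by
    rw [real_inner_comm, inner_const_one, integral_centre]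
  rw [centre_apply g, inner_sub_right, inner_smul_right, h, mul_zero, sub_zero, centre_apply,
    inner_sub_left, inner_smul_left, inner_const_one]
  simp

lemma norm_centre_le (f : Lp ℝ 2 P) : ‖centre P f‖ ≤ ‖f‖ := by
  refine le_of_sq_le_sq ?_ (norm_nonneg _)
  rw [← real_inner_self_eq_norm_sq, inner_centre, real_inner_self_eq_norm_sq]
  nlinarith [mul_self_nonneg (∫ ω, f ω ∂P)]

end Centre

/-! ### Covariances of products of noise coordinates -/

variable {Ω : Type*} [MeasurableSpace Ω] {ι : Type*}

/-- iid centred random vectors with finite fourth moments. -/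
structure IsNoise (P : Measure Ω) (x : ℤ → Ω → ι → ℝ) : Prop where
  measurable : ∀ k, Measurable (x k)
  indep : iIndepFun x P
  ident : ∀ k l, IdentDistrib (x k) (x l) P P
  memLp : ∀ k a, MemLp (fun ω => x k ω a) 4 P
  mean : ∀ k a, ∫ ω, x k ω a ∂P = 0

namespace IsNoise

variable {P : Measure Ω} {x : ℤ → Ω → ι → ℝ} [IsProbabilityMeasure P]

lemma measurable_coord (hx : IsNoise P x) (k : ℤ) (a : ι) : Measurable fun ω => x k ω a :=
  (measurable_pi_apply a).comp (hx.measurable k)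

lemma memLp_mul (hx : IsNoise P x) (s u : ℤ) (p : ι × ι) :
    MemLp (fun ω => x s ω p.1 * x u ω p.2) 2 P := by
  -- Hölder with 1/4 + 1/4 = 1/2: the fourth moment puts the products, even at equal times, into L².
  have : ENNReal.HolderTriple 4 4 2 := ⟨by
    rw [← ENNReal.toReal_eq_toReal_iff' (by simp) (by simp)]
    rw [ENNReal.toReal_add (by simp) (by simp)]
    norm_num⟩
  exact (hx.memLp u p.2).mul (hx.memLp s p.1)

/-- The product of two coordinates of the noise, at times `s` and `u`, as an element of `L²`. -/
noncomputable def prodLp (hx : IsNoise P x) (s u : ℤ) (p : ι × ι) : Lp ℝ 2 P :=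
  (hx.memLp_mul s u p).toLp

/-- The centred product of two coordinates of the noise, at times `s` and `u`. -/
noncomputable def cprodLp (hx : IsNoise P x) (s u : ℤ) (p : ι × ι) : Lp ℝ 2 P :=
  centre P (hx.prodLp s u p)

/-- A coordinate of the noise as an element of `L²`. -/
noncomputable def coordLp (hx : IsNoise P x) (k : ℤ) (a : ι) : Lp ℝ 2 P :=
  ((hx.memLp k a).mono_exponent (by norm_num : (2 : ℝ≥0∞) ≤ 4)).toLp

lemma prodLp_coeFn (hx : IsNoise P x) (s u : ℤ) (p : ι × ι) :
    hx.prodLp s u p =ᵐ[P] fun ω => x s ω p.1 * x u ω p.2 := MemLp.coeFn_toLp _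

lemma coordLp_coeFn (hx : IsNoise P x) (k : ℤ) (a : ι) :
    hx.coordLp k a =ᵐ[P] fun ω => x k ω a := MemLp.coeFn_toLp _

lemma integral_mul_of_ne (hx : IsNoise P x) {s u : ℤ} (h : s ≠ u) {f g : (ι → ℝ) → ℝ}
    (hf : Measurable f) (hg : Measurable g) :
    ∫ ω, f (x s ω) * g (x u ω) ∂P = (∫ ω, f (x s ω) ∂P) * ∫ ω, g (x u ω) ∂P :=
  ((hx.indep.indepFun h).comp hf hg).integral_fun_mul_eq_mul_integral
    (hf.comp (hx.measurable s)).aestronglyMeasurable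
    (hg.comp (hx.measurable u)).aestronglyMeasurable

/-- A product in which one time occurs exactly once has expectation zero. -/
lemma integral_mul_eq_zero (hx : IsNoise P x) {τ i j k : ℤ} (hi : τ ≠ i) (hj : τ ≠ j) (hk : τ ≠ k)
    (a b c d : ι) : ∫ ω, x τ ω a * (x i ω b * (x j ω c * x k ω d)) ∂P = 0 := by
  have h := hx.indep.indepFun_finset {τ} {i, j, k} (by simp [hi, hj, hk]) hx.measurable
  have h1 : ∫ ω, x τ ω a * (x i ω b * (x j ω c * x k ω d)) ∂P
      = (∫ ω, x τ ω a ∂P) * ∫ ω, x i ω b * (x j ω c * x k ω d) ∂P := by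
    refine IndepFun.integral_fun_mul_eq_mul_integral (X := fun ω => x τ ω a)
      (Y := fun ω => x i ω b * (x j ω c * x k ω d)) ?_ ?_ ?_
    · exact h.comp (φ := fun v : (({τ} : Finset ℤ) → ι → ℝ) => v ⟨τ, by simp⟩ a)
        (ψ := fun v : (({i, j, k} : Finset ℤ) → ι → ℝ) =>
          v ⟨i, by simp⟩ b * (v ⟨j, by simp⟩ c * v ⟨k, by simp⟩ d)) (by fun_prop) (by fun_prop)
    · exact (hx.measurable_coord τ a).aestronglyMeasurable
    · exact ((hx.measurable_coord i b).mul
        ((hx.measurable_coord j c).mul (hx.measurable_coord k d))).aestronglyMeasurable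
  rw [h1, hx.mean, zero_mul]

lemma integral_pair (hx : IsNoise P x) (s u : ℤ) (a b : ι) :
    ∫ ω, x s ω a * x u ω b ∂P = if s = u then ∫ ω, x 1 ω a * x 1 ω b ∂P else 0 := by
  split_ifs with h
  · subst h
    exact ((hx.ident s 1).comp (u := fun v : ι → ℝ => v a * v b) (by fun_prop)).integral_eq
  · rw [hx.integral_mul_of_ne h (f := fun v => v a) (g := fun v => v b) (by fun_prop)
      (by fun_prop), hx.mean, zero_mul]

lemma integral_prodLp (hx : IsNoise P x) (s u : ℤ) (p : ι × ι) :
    ∫ ω, hx.prodLp s u p ω ∂P = if s = u then ∫ ω, x 1 ω p.1 * x 1 ω p.2 ∂P else 0 := by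
  rw [integral_congr_ae (hx.prodLp_coeFn s u p), hx.integral_pair]

lemma inner_prodLp (hx : IsNoise P x) (s u s' u' : ℤ) (p p' : ι × ι) :
    ⟪hx.prodLp s u p, hx.prodLp s' u' p'⟫_ℝ
      = ∫ ω, (x s ω p.1 * x u ω p.2) * (x s' ω p'.1 * x u' ω p'.2) ∂P := by
  rw [L2.inner_def]
  refine integral_congr_ae ?_
  filter_upwards [hx.prodLp_coeFn s u p, hx.prodLp_coeFn s' u' p'] with ω h1 h2
  rw [h1, h2, real_inner_comm]
  rfl

lemma inner_cprodLp (hx : IsNoise P x) (s u s' u' : ℤ) (p p' : ι × ι) :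
    ⟪hx.cprodLp s u p, hx.cprodLp s' u' p'⟫_ℝ
      = ∫ ω, (x s ω p.1 * x u ω p.2) * (x s' ω p'.1 * x u' ω p'.2) ∂P
        - (if s = u then ∫ ω, x 1 ω p.1 * x 1 ω p.2 ∂P else 0)
          * (if s' = u' then ∫ ω, x 1 ω p'.1 * x 1 ω p'.2 ∂P else 0) := by
  rw [cprodLp, cprodLp, inner_centre, inner_prodLp, integral_prodLp, integral_prodLp]

/-- The hypotheses say that the unordered pairs of times differ. If both pairs have equal entries,
the two products are independent. Otherwise the product of the means vanishes and some time occurs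
exactly once among the four, so the centred noise at that time annihilates the expectation. -/
lemma inner_cprodLp_eq_zero (hx : IsNoise P x) {s u s' u' : ℤ} (h1 : ¬(s = s' ∧ u = u'))
    (h2 : ¬(s = u' ∧ u = s')) (p p' : ι × ι) :
    ⟪hx.cprodLp s u p, hx.cprodLp s' u' p'⟫_ℝ = 0 := by
  rw [inner_cprodLp]
  by_cases hd : s = u ∧ s' = u'
  · obtain ⟨rfl, rfl⟩ := hd
    rw [hx.integral_mul_of_ne (fun h => h1 ⟨h, h⟩) (f := fun v => v p.1 * v p.2)
      (g := fun v => v p'.1 * v p'.2) (by fun_prop) (by fun_prop),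
      hx.integral_pair s s, hx.integral_pair s' s', sub_self]
  · have h0 : (if s = u then ∫ ω, x 1 ω p.1 * x 1 ω p.2 ∂P else 0)
        * (if s' = u' then ∫ ω, x 1 ω p'.1 * x 1 ω p'.2 ∂P else 0) = 0 := by
      rcases not_and_or.1 hd with h | h <;> simp [h]
    rw [h0, sub_zero]
    have hcase : (s ≠ u ∧ s ≠ s' ∧ s ≠ u') ∨ (u ≠ s ∧ u ≠ s' ∧ u ≠ u')
        ∨ (s' ≠ s ∧ s' ≠ u ∧ s' ≠ u') ∨ (u' ≠ s ∧ u' ≠ u ∧ u' ≠ s') := by omega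
    rcases hcase with ⟨h3, h4, h5⟩ | ⟨h3, h4, h5⟩ | ⟨h3, h4, h5⟩ | ⟨h3, h4, h5⟩
    · rw [← hx.integral_mul_eq_zero h3 h4 h5 p.1 p.2 p'.1 p'.2]
      exact integral_congr_ae (Eventually.of_forall fun ω => by ring)
    · rw [← hx.integral_mul_eq_zero h3 h4 h5 p.2 p.1 p'.1 p'.2]
      exact integral_congr_ae (Eventually.of_forall fun ω => by ring)
    · rw [← hx.integral_mul_eq_zero h3 h4 h5 p'.1 p.1 p.2 p'.2]
      exact integral_congr_ae (Eventually.of_forall fun ω => by ring)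
    · rw [← hx.integral_mul_eq_zero h3 h4 h5 p'.2 p.1 p.2 p'.1]
      exact integral_congr_ae (Eventually.of_forall fun ω => by ring)

/-- Equal times: stationarity moves the covariance to time 1, where it is an entry of Υ*. -/
lemma inner_cprodLp_diag (hx : IsNoise P x) (s : ℤ) (p p' : ι × ι) :
    ⟪hx.cprodLp s s p, hx.cprodLp s s p'⟫_ℝ
      = ∫ ω, (x 1 ω p.1 * x 1 ω p.2) * (x 1 ω p'.1 * x 1 ω p'.2) ∂P
        - (∫ ω, x 1 ω p.1 * x 1 ω p.2 ∂P) * ∫ ω, x 1 ω p'.1 * x 1 ω p'.2 ∂P := by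
  rw [inner_cprodLp, if_pos rfl, if_pos rfl]
  congr 1
  exact ((hx.ident s 1).comp
    (u := fun v : ι → ℝ => (v p.1 * v p.2) * (v p'.1 * v p'.2)) (by fun_prop)).integral_eq

/-- Independence of the two times factorizes the expectation into an entry of Σ_ξ ⊗ Σ_ξ. -/
lemma inner_cprodLp_same (hx : IsNoise P x) {s u : ℤ} (h : s ≠ u) (p p' : ι × ι) :
    ⟪hx.cprodLp s u p, hx.cprodLp s u p'⟫_ℝ
      = (∫ ω, x 1 ω p.1 * x 1 ω p'.1 ∂P) * ∫ ω, x 1 ω p.2 * x 1 ω p'.2 ∂P := by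
  have h1 := hx.integral_mul_of_ne h (f := fun v => v p.1 * v p'.1)
    (g := fun v => v p.2 * v p'.2) (by fun_prop) (by fun_prop)
  rw [hx.integral_pair s s, hx.integral_pair u u, if_pos rfl, if_pos rfl] at h1
  rw [inner_cprodLp, if_neg h, zero_mul, sub_zero, ← h1]
  exact integral_congr_ae (Eventually.of_forall fun ω => by ring)

/-- The same two noise vectors occur with their roles exchanged; this is the origin of the
permutation matrix P_{m,m} in the limit. -/
lemma inner_cprodLp_swap (hx : IsNoise P x) {s u : ℤ} (h : s ≠ u) (p p' : ι × ι) :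
    ⟪hx.cprodLp s u p, hx.cprodLp u s p'⟫_ℝ
      = (∫ ω, x 1 ω p.1 * x 1 ω p'.2 ∂P) * ∫ ω, x 1 ω p.2 * x 1 ω p'.1 ∂P := by
  have h1 := hx.integral_mul_of_ne h (f := fun v => v p.1 * v p'.2)
    (g := fun v => v p.2 * v p'.1) (by fun_prop) (by fun_prop)
  rw [hx.integral_pair s s, hx.integral_pair u u, if_pos rfl, if_pos rfl] at h1
  rw [inner_cprodLp, if_neg h, zero_mul, sub_zero, ← h1]
  exact integral_congr_ae (Eventually.of_forall fun ω => by ring)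

/-- Products of noise coordinates are bounded in `L²`, uniformly in the times. -/
lemma exists_norm_prodLp_le [Finite ι] (hx : IsNoise P x) :
    ∃ M : ℝ, 0 ≤ M ∧ ∀ s u p, ‖hx.prodLp s u p‖ ≤ M := by
  have := Fintype.ofFinite ι
  have hsq : ∀ s u p, ‖hx.prodLp s u p‖ ^ 2 =
      if s = u then ∫ ω, (x 1 ω p.1 ^ 2) * (x 1 ω p.2 ^ 2) ∂P
        else (∫ ω, x 1 ω p.1 ^ 2 ∂P) * ∫ ω, x 1 ω p.2 ^ 2 ∂P := by
    intro s u p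
    have h0 : ∀ (s : ℤ) (a : ι), ∫ ω, x s ω a ^ 2 ∂P = ∫ ω, x 1 ω a ^ 2 ∂P := fun s a =>
      ((hx.ident s 1).comp (u := fun v : ι → ℝ => v a ^ 2) (by fun_prop)).integral_eq
    rw [← real_inner_self_eq_norm_sq, inner_prodLp]
    split_ifs with h
    · subst h
      refine Eq.trans ?_ ((hx.ident s 1).comp (u := fun v : ι → ℝ => v p.1 ^ 2 * v p.2 ^ 2)
        (by fun_prop)).integral_eq
      exact integral_congr_ae (Eventually.of_forall fun ω => by simp only [Function.comp]; ring)
    · rw [← h0 s, ← h0 u, ← hx.integral_mul_of_ne h (f := fun v => v p.1 ^ 2)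
        (g := fun v => v p.2 ^ 2) (by fun_prop) (by fun_prop)]
      exact integral_congr_ae (Eventually.of_forall fun ω => by ring)
  -- The norm depends only on `p` and on whether `s = u`, hence takes finitely many values; the sum
  -- of all of them is a uniform bound.
  refine ⟨∑ p : ι × ι, (√(∫ ω, (x 1 ω p.1 ^ 2) * (x 1 ω p.2 ^ 2) ∂P)
    + √((∫ ω, x 1 ω p.1 ^ 2 ∂P) * ∫ ω, x 1 ω p.2 ^ 2 ∂P)), by positivity, fun s u p => ?_⟩
  refine le_trans ?_ (Finset.single_le_sum (f := fun p : ι × ι =>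
    (√(∫ ω, (x 1 ω p.1 ^ 2) * (x 1 ω p.2 ^ 2) ∂P)
      + √((∫ ω, x 1 ω p.1 ^ 2 ∂P) * ∫ ω, x 1 ω p.2 ^ 2 ∂P)))
    (fun _ _ => by positivity) (Finset.mem_univ p))
  rw [← Real.sqrt_sq (norm_nonneg (hx.prodLp s u p)), hsq]
  split_ifs
  · exact le_add_of_nonneg_right (Real.sqrt_nonneg _)
  · exact le_add_of_nonneg_left (Real.sqrt_nonneg _)

lemma inner_coordLp (hx : IsNoise P x) (k l : ℤ) (a b : ι) :
    ⟪hx.coordLp k a, hx.coordLp l b⟫_ℝ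
      = if k = l then ∫ ω, x 1 ω a * x 1 ω b ∂P else 0 := by
  rw [← hx.integral_pair, L2.inner_def]
  refine integral_congr_ae ?_
  filter_upwards [hx.coordLp_coeFn k a, hx.coordLp_coeFn l b] with ω h1 h2
  rw [h1, h2, real_inner_comm]
  rfl

lemma exists_norm_coordLp_le [Finite ι] (hx : IsNoise P x) :
    ∃ M : ℝ, 0 ≤ M ∧ ∀ k a, ‖hx.coordLp k a‖ ≤ M := by
  have := Fintype.ofFinite ι
  refine ⟨∑ a, √(∫ ω, x 1 ω a * x 1 ω a ∂P), by positivity, fun k a => ?_⟩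
  refine le_trans ?_ (Finset.single_le_sum (f := fun a => √(∫ ω, x 1 ω a * x 1 ω a ∂P))
    (fun _ _ => by positivity) (Finset.mem_univ a))
  rw [← Real.sqrt_sq (norm_nonneg (hx.coordLp k a)), ← real_inner_self_eq_norm_sq, inner_coordLp,
    if_pos rfl]

end IsNoise


/-! ### Tails of series and time shifts of sums -/

section Banach

variable {κ H : Type*} [NormedAddCommGroup H] [CompleteSpace H]

lemma norm_tsum_sub_sum_le {f : κ → H} {bd : κ → ℝ} (hbd : Summable bd) (h : ∀ i, ‖f i‖ ≤ bd i)
    (F : Finset κ) : ‖∑' i, f i - ∑ i ∈ F, f i‖ ≤ ∑' i, bd i - ∑ i ∈ F, bd i := by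
  have hf : Summable f := Summable.of_norm_bounded hbd h
  rw [← hf.sum_add_tsum_subtype_compl F, ← hbd.sum_add_tsum_subtype_compl F,
    add_sub_cancel_left, add_sub_cancel_left]
  exact tsum_of_norm_bounded (hbd.subtype _).hasSum fun i => h i

omit [CompleteSpace H] in
-- A shift by one step telescopes to two boundary terms, and |e| such steps suffice. The bound is
-- free of `n`, so it disappears after division by √n.
lemma norm_sum_shift_sub_le {g : ℤ → H} {M : ℝ} (hg : ∀ k, ‖g k‖ ≤ M) (n : ℕ) (e : ℤ) :
    ‖∑ k ∈ Finset.range n, g (k + 1 + e) - ∑ k ∈ Finset.range n, g (k + 1)‖ ≤ 2 * M * |e| := by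
  have hstep : ∀ e : ℤ, ‖∑ k ∈ Finset.range n, g (k + 1 + (e + 1))
      - ∑ k ∈ Finset.range n, g (k + 1 + e)‖ ≤ 2 * M := by
    intro e
    have h := Finset.sum_range_sub (fun k : ℕ => g (k + 1 + e)) n
    rw [← Finset.sum_sub_distrib]
    have h' : ∀ k ∈ Finset.range n, g (k + 1 + (e + 1)) - g (k + 1 + e)
        = g ((k + 1 : ℕ) + 1 + e) - g (k + 1 + e) := fun k _ => by
      congr 2; push_cast; ring
    rw [Finset.sum_congr rfl h', h]
    refine (norm_sub_le _ _).trans ?_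
    linarith [hg (n + 1 + e), hg ((0 : ℕ) + 1 + e)]
  induction e using Int.induction_on with
  | zero => simp
  | succ i ih =>
    have h1 := hstep i
    have h2 := norm_add_le (∑ k ∈ Finset.range n, g (k + 1 + ((i : ℤ) + 1))
      - ∑ k ∈ Finset.range n, g (k + 1 + (i : ℤ)))
      (∑ k ∈ Finset.range n, g (k + 1 + (i : ℤ)) - ∑ k ∈ Finset.range n, g (k + 1))
    rw [sub_add_sub_cancel] at h2
    have h3 : ((|(i : ℤ) + 1| : ℤ) : ℝ) = i + 1 := by
      rw [abs_of_nonneg (by positivity)]; push_cast; ring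
    have h4 : ((|(i : ℤ)| : ℤ) : ℝ) = i := by
      rw [abs_of_nonneg (by positivity)]; push_cast; ring
    rw [h4] at ih
    rw [h3]
    linarith
  | pred i ih =>
    have h1 := hstep (-(i : ℤ) - 1)
    rw [sub_add_cancel, norm_sub_rev] at h1
    have h2 := norm_add_le (∑ k ∈ Finset.range n, g (k + 1 + (-(i : ℤ) - 1))
      - ∑ k ∈ Finset.range n, g (k + 1 + -(i : ℤ)))
      (∑ k ∈ Finset.range n, g (k + 1 + -(i : ℤ)) - ∑ k ∈ Finset.range n, g (k + 1))
    rw [sub_add_sub_cancel] at h2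
    have h3 : ((|-(i : ℤ) - 1| : ℤ) : ℝ) = i + 1 := by
      rw [abs_of_nonpos (by omega)]; push_cast; ring
    have h4 : ((|-(i : ℤ)| : ℤ) : ℝ) = i := by
      rw [abs_of_nonpos (by omega)]; push_cast; ring
    rw [h4] at ih
    rw [h3]
    linarith

lemma tendsto_const_mul_inv_sqrt (c : ℝ) :
    Tendsto (fun n : ℕ => (√(n : ℝ))⁻¹ * c) atTop (𝓝 0) := by
  have h := (tendsto_inv_atTop_zero.comp
    (Real.tendsto_sqrt_atTop.comp tendsto_natCast_atTop_atTop)).mul_const c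
  simpa using h

/-- Only an inequality, because the left side is 0 at `n = 0`. -/
lemma inv_sqrt_mul_sqrt_le (n : ℕ) : (√(n : ℝ))⁻¹ * √(n : ℝ) ≤ 1 := by
  rcases (Real.sqrt_nonneg (n : ℝ)).eq_or_lt with h | h
  · simp [← h]
  · rw [inv_mul_cancel₀ h.ne']

end Banach

/-! ### Stationarity of finite-range functionals -/

section FiniteRangeStationary

variable {Ω : Type*} [MeasurableSpace Ω] {P : Measure Ω}
  {E : Type*} [MeasurableSpace E] {x : ℤ → Ω → E}
  {D : ℕ} {G : (Fin (D + 1) → E) → ℝ} {Z : ℤ → Lp ℝ 2 P}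

lemma norm_eq_of_finite_range [IsProbabilityMeasure P]
    (hx : ∀ k, Measurable (x k)) (hind : iIndepFun x P)
    (hid : ∀ k l, IdentDistrib (x k) (x l) P P) (hG : Measurable G)
    (hZ : ∀ k, Z k =ᵐ[P] fun ω => G fun l => x (k - (l : ℕ)) ω) (k : ℤ) : ‖Z k‖ = ‖Z 0‖ := by
  have hrow : ∀ k : ℤ, iIndepFun (fun l : Fin (D + 1) => x (k - (l : ℕ))) P := fun k =>
    hind.precomp (g := fun l : Fin (D + 1) => k - ((l : ℕ) : ℤ)) fun a b hab => by
      ext; simpa using hab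
  have h := (identDistrib_family (fun _ => hx _) (fun _ => hx _) (hrow k) (hrow 0)
    fun j => hid _ _).comp (u := fun v => G v ^ 2) (hG.pow_const 2)
  rw [← abs_of_nonneg (norm_nonneg (Z k)), ← abs_of_nonneg (norm_nonneg (Z 0)), ← sq_eq_sq_iff_abs_eq_abs,
    ← integral_sq_eq_norm_sq, ← integral_sq_eq_norm_sq,
    integral_congr_ae ((hZ k).mono fun ω hω => congrArg (· ^ 2) hω),
    integral_congr_ae ((hZ 0).mono fun ω hω => congrArg (· ^ 2) hω)]
  exact h.integral_eq

end FiniteRangeStationary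

/-! ### Central limit theorem for bilinear forms in the noise -/

namespace IsNoise

variable {Ω : Type*} [MeasurableSpace Ω] {ι : Type*} {P : Measure Ω} {x : ℤ → Ω → ι → ℝ}
  [IsProbabilityMeasure P]

/-- The centred products with time difference `-δ`, the larger of the two times being `k`. -/
noncomputable def lagLp (hx : IsNoise P x) (k δ : ℤ) (p : ι × ι) : Lp ℝ 2 P :=
  hx.cprodLp (k - max δ 0) (k - max (-δ) 0) p

lemma cprodLp_eq_lagLp (hx : IsNoise P x) (k i j : ℤ) (p : ι × ι) :
    hx.cprodLp (k - i) (k - j) p = hx.lagLp (k + -min i j) (i - j) p := by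
  rw [lagLp]
  congr 1 <;> omega

/-- Pairs with different later times are different as unordered pairs. Indexing by the later time
thus gives orthogonality in time for all lags simultaneously, as the block argument requires. -/
lemma inner_lagLp_eq_zero (hx : IsNoise P x) {k l : ℤ} (h : k ≠ l) (δ δ' : ℤ) (p p' : ι × ι) :
    ⟪hx.lagLp k δ p, hx.lagLp l δ' p'⟫_ℝ = 0 :=
  hx.inner_cprodLp_eq_zero (by omega) (by omega) p p'

/-- Lags δ and −δ use the same two times in opposite order; no other two distinct lags share their
pair of times. -/
lemma inner_lagLp_eq_zero_of_lag (hx : IsNoise P x) (k : ℤ) {δ δ' : ℤ} (h : δ ≠ δ') (h' : δ ≠ -δ')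
    (p p' : ι × ι) : ⟪hx.lagLp k δ p, hx.lagLp k δ' p'⟫_ℝ = 0 :=
  hx.inner_cprodLp_eq_zero (by omega) (by omega) p p'

lemma exists_norm_cprodLp_le [Finite ι] (hx : IsNoise P x) :
    ∃ M : ℝ, 0 ≤ M ∧ ∀ s u p, ‖hx.cprodLp s u p‖ ≤ M := by
  obtain ⟨M, hM, h⟩ := hx.exists_norm_prodLp_le
  exact ⟨M, hM, fun s u p => (norm_centre_le _).trans (h s u p)⟩

/-- Orthogonality in time makes the normalized sums bounded uniformly in `n`, the shift and the lag,
so series over lags can be truncated uniformly in `n`. -/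
lemma norm_sum_lagLp_le (hx : IsNoise P x) {M : ℝ} (hM : 0 ≤ M)
    (h : ∀ s u p, ‖hx.cprodLp s u p‖ ≤ M) (e δ : ℤ) (p : ι × ι) (n : ℕ) :
    ‖(√(n : ℝ))⁻¹ • ∑ k ∈ Finset.range n, hx.lagLp (k + 1 + e) δ p‖ ≤ M := by
  have h1 := norm_sum_le_of_orthogonal hM (Finset.range n)
    (z := fun k : ℕ => hx.lagLp (k + 1 + e) δ p)
    (fun i _ j _ hij => hx.inner_lagLp_eq_zero (by simpa using hij) _ _ _ _)
    (fun i _ => h _ _ _)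
  rw [Finset.card_range] at h1
  rw [norm_smul, norm_inv, Real.norm_of_nonneg (Real.sqrt_nonneg _)]
  calc (√(n : ℝ))⁻¹ * _ ≤ (√(n : ℝ))⁻¹ * (M * √n) := by gcongr
    _ = M * ((√(n : ℝ))⁻¹ * √n) := by ring
    _ ≤ M * 1 := by gcongr; exact inv_sqrt_mul_sqrt_le n
    _ = M := mul_one M

variable [Fintype ι]

lemma norm_sum_smul_le {H : Type*} [NormedAddCommGroup H] [NormedSpace ℝ H] {M : ℝ} (b : ι → ℝ)
    {f : ι → H} (h : ∀ p, ‖f p‖ ≤ M) : ‖∑ p, b p • f p‖ ≤ M * ∑ p, |b p| := by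
  rw [Finset.mul_sum]
  refine norm_sum_le_of_le _ fun p _ => ?_
  rw [norm_smul, Real.norm_eq_abs, mul_comm]
  gcongr
  exact h p

/-- The central limit theorem for finite combinations of lagged products. -/
lemma tendsto_cfOne_sum_lagLp (hx : IsNoise P x) (b : ℤ → ι × ι → ℝ) (F : Finset ℤ) :
    Tendsto (fun n : ℕ => cfOne P
        ((∑ δ ∈ F, ∑ p, b δ p • ((√(n : ℝ))⁻¹ • ∑ k ∈ Finset.range n, hx.lagLp (k + 1) δ p))
          : Lp ℝ 2 P))
      atTop (𝓝 (Complex.exp (-((‖∑ δ ∈ F, ∑ p, b δ p • hx.lagLp 0 δ p‖ ^ 2 / 2 : ℝ) : ℂ)))) := by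
  set D : ℕ := F.sup Int.natAbs with hD
  have hDle : ∀ δ ∈ F, δ.natAbs ≤ D := fun δ hδ => Finset.le_sup (f := Int.natAbs) hδ
  set Z : ℤ → Lp ℝ 2 P := fun k => ∑ δ ∈ F, ∑ p, b δ p • hx.lagLp k δ p with hZdef
  -- `D` is the largest |δ| in `F`, so the `min` with `D` serves only to produce an element of `Fin
  -- (D + 1)` and is inactive for δ in `F`.
  set G : (Fin (D + 1) → ι → ℝ) → ℝ := fun v => ∑ δ ∈ F, ∑ p : ι × ι, b δ p *
    (v ⟨min (max δ 0).toNat D, by omega⟩ p.1 * v ⟨min (max (-δ) 0).toNat D, by omega⟩ p.2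
      - if δ = 0 then ∫ ω, x 1 ω p.1 * x 1 ω p.2 ∂P else 0) with hGdef
  have hG : Measurable G := by
    refine Finset.measurable_sum _ fun δ _ => Finset.measurable_sum _ fun p _ => ?_
    fun_prop
  have hZ : ∀ k, Z k =ᵐ[P] fun ω => G fun l => x (k - (l : ℕ)) ω := by
    intro k
    have h1 : ∀ δ ∈ F, ((∑ p, b δ p • hx.lagLp k δ p : Lp ℝ 2 P) : Ω → ℝ) =ᵐ[P] fun ω =>
        ∑ p : ι × ι, b δ p * (x (k - (min (max δ 0).toNat D : ℕ)) ω p.1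
          * x (k - (min (max (-δ) 0).toNat D : ℕ)) ω p.2
          - if δ = 0 then ∫ ω, x 1 ω p.1 * x 1 ω p.2 ∂P else 0) := by
      intro δ hδ
      have hle := hDle δ hδ
      have e1 : ((min (max δ 0).toNat D : ℕ) : ℤ) = max δ 0 := by omega
      have e2 : ((min (max (-δ) 0).toNat D : ℕ) : ℤ) = max (-δ) 0 := by omega
      have e3 : (k - max δ 0 = k - max (-δ) 0) ↔ δ = 0 := by omega
      rw [e1, e2]
      have h2 : ∀ᵐ ω ∂P, ∀ p, (b δ p • hx.lagLp k δ p : Lp ℝ 2 P) ω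
          = b δ p * (x (k - max δ 0) ω p.1 * x (k - max (-δ) 0) ω p.2
            - if δ = 0 then ∫ ω, x 1 ω p.1 * x 1 ω p.2 ∂P else 0) := by
        refine ae_all_iff.2 fun p => ?_
        filter_upwards [Lp.coeFn_smul (b δ p) (hx.lagLp k δ p),
          centre_coeFn (hx.prodLp (k - max δ 0) (k - max (-δ) 0) p),
          hx.prodLp_coeFn (k - max δ 0) (k - max (-δ) 0) p] with ω h3 h4 h5
        rw [h3, Pi.smul_apply, lagLp, cprodLp, h4, h5, hx.integral_prodLp, smul_eq_mul]
        simp only [e3]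
      filter_upwards [Lp_coeFn_sum Finset.univ fun p => b δ p • hx.lagLp k δ p, h2] with ω h3 h4
      rw [h3]
      exact Finset.sum_congr rfl fun p _ => h4 p
    have h2 : ∀ᵐ ω ∂P, ∀ δ ∈ F, (∑ p, b δ p • hx.lagLp k δ p : Lp ℝ 2 P) ω =
        ∑ p : ι × ι, b δ p * (x (k - (min (max δ 0).toNat D : ℕ)) ω p.1
          * x (k - (min (max (-δ) 0).toNat D : ℕ)) ω p.2
          - if δ = 0 then ∫ ω, x 1 ω p.1 * x 1 ω p.2 ∂P else 0) :=
      (ae_ball_iff F.countable_toSet).2 h1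
    filter_upwards [Lp_coeFn_sum F fun δ => ∑ p, b δ p • hx.lagLp k δ p, h2] with ω h3 h4
    rw [hZdef, h3]
    exact Finset.sum_congr rfl h4
  have horth : ∀ k l, k ≠ l → ⟪Z k, Z l⟫_ℝ = 0 := by
    intro k l hkl
    simp only [hZdef, sum_inner, inner_sum, inner_smul_left, inner_smul_right,
      hx.inner_lagLp_eq_zero hkl]
    simp
  have hmean : ∀ k, ∫ ω, Z k ω ∂P = 0 := by
    intro k
    have : Z k = centre P (∑ δ ∈ F, ∑ p, b δ p • hx.prodLp (k - max δ 0) (k - max (-δ) 0) p) := by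
      simp only [hZdef, map_sum, map_smul]
      rfl
    rw [this, integral_centre]
  have h := tendsto_cfOne_sum_of_finite_range hx.measurable hx.indep hx.ident hG hZ horth
    (norm_eq_of_finite_range hx.measurable hx.indep hx.ident hG hZ) hmean
  refine h.congr fun n => ?_
  have heq : (√(n : ℝ))⁻¹ • ∑ k ∈ Finset.range n, Z (k + 1)
      = ∑ δ ∈ F, ∑ p, b δ p • ((√(n : ℝ))⁻¹ • ∑ k ∈ Finset.range n, hx.lagLp (k + 1) δ p) := by
    rw [hZdef, Finset.sum_comm, Finset.smul_sum]
    refine Finset.sum_congr rfl fun δ _ => ?_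
    rw [Finset.sum_comm, Finset.smul_sum]
    refine Finset.sum_congr rfl fun p _ => ?_
    rw [← Finset.smul_sum, smul_comm]
  rw [heq]

/-- The central limit theorem for absolutely summable combinations of lagged products. -/
lemma tendsto_cfOne_tsum_lagLp (hx : IsNoise P x) {b : ℤ → ι × ι → ℝ}
    (hb : Summable fun δ => ∑ p, |b δ p|) :
    Tendsto (fun n : ℕ => cfOne P
        ((∑' δ, ∑ p, b δ p • ((√(n : ℝ))⁻¹ • ∑ k ∈ Finset.range n, hx.lagLp (k + 1) δ p))
          : Lp ℝ 2 P))
      atTop (𝓝 (Complex.exp (-((‖∑' δ, ∑ p, b δ p • hx.lagLp 0 δ p‖ ^ 2 / 2 : ℝ) : ℂ)))) := by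
  obtain ⟨M, hM0, hM⟩ := hx.exists_norm_cprodLp_le
  have hbd : Summable fun δ => M * ∑ p, |b δ p| := hb.mul_left M
  have hs : Summable fun δ => ∑ p, b δ p • hx.lagLp 0 δ p :=
    Summable.of_norm_bounded hbd fun δ => norm_sum_smul_le _ fun p => hM _ _ _
  have hcont : Continuous fun z : Lp ℝ 2 P => Complex.exp (-((‖z‖ ^ 2 / 2 : ℝ) : ℂ)) := by fun_prop
  have hsum : Tendsto (fun F : Finset ℤ => ∑ δ ∈ F, ∑ p, b δ p • hx.lagLp 0 δ p) atTop
    (𝓝 (∑' δ, ∑ p, b δ p • hx.lagLp 0 δ p)) := hs.hasSum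
  have hlim := (hcont.tendsto _).comp hsum
  have hlim2 : Tendsto (fun F : Finset ℤ => ∑' δ, M * ∑ p, |b δ p| - ∑ δ ∈ F, M * ∑ p, |b δ p|)
      atTop (𝓝 0) := by
    have h : Tendsto (fun F : Finset ℤ => ∑ δ ∈ F, M * ∑ p, |b δ p|) atTop _ := hbd.hasSum
    simpa using h.const_sub (∑' δ, M * ∑ p, |b δ p|)
  refine tendsto_cfOne_of_approx fun ε hε => ?_
  -- One finite set of lags serves all `n`: the tail of the dominating series bounds the truncation
  -- error of every normalized sum.
  obtain ⟨F, h1, h2⟩ := ((Metric.tendsto_nhds.1 hlim ε hε).and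
    (hlim2.eventually_lt_const hε)).exists
  refine ⟨_, _, by rwa [dist_eq_norm] at h1, hx.tendsto_cfOne_sum_lagLp b F,
    Eventually.of_forall fun n => lt_of_le_of_lt (norm_tsum_sub_sum_le hbd (fun δ => ?_) F) h2⟩
  refine norm_sum_smul_le _ fun p => ?_
  simpa using hx.norm_sum_lagLp_le hM0 hM 0 δ p n

/-- The later time of the product is k + 1 − min(i, j), so the two sums are time shifts of each
other by a fixed amount and differ by O(1) before normalization. -/
lemma tendsto_norm_cprodLp_sub_lagLp (hx : IsNoise P x) (i j : ℤ) (p : ι × ι) :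
    Tendsto (fun n : ℕ => ‖(√(n : ℝ))⁻¹ • ∑ k ∈ Finset.range n, hx.cprodLp (k + 1 - i) (k + 1 - j) p
      - (√(n : ℝ))⁻¹ • ∑ k ∈ Finset.range n, hx.lagLp (k + 1) (i - j) p‖) atTop (𝓝 0) := by
  obtain ⟨M, hM0, hM⟩ := hx.exists_norm_cprodLp_le
  refine squeeze_zero (fun _ => norm_nonneg _) (fun n => ?_)
    (tendsto_const_mul_inv_sqrt (2 * M * |-min i j|))
  simp only [cprodLp_eq_lagLp]
  rw [← smul_sub, norm_smul, norm_inv, Real.norm_of_nonneg (Real.sqrt_nonneg _)]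
  gcongr
  simpa using norm_sum_shift_sub_le (g := fun k => hx.lagLp k (i - j) p) (fun k => hM _ _ _) n
    (-min i j)

/-- Reindexing pairs of integers by their difference and the second entry. -/
def diffEquiv : ℤ × ℤ ≃ ℤ × ℤ where
  toFun q := (q.2 + q.1, q.2)
  invFun q := (q.1 - q.2, q.2)
  left_inv q := by ext <;> simp
  right_inv q := by ext <;> simp

lemma norm_sum_cprodLp_le (hx : IsNoise P x) {M : ℝ} (hM0 : 0 ≤ M)
    (hM : ∀ s u p, ‖hx.cprodLp s u p‖ ≤ M) (n : ℕ) (i j : ℤ) (p : ι × ι) :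
    ‖(√(n : ℝ))⁻¹ • ∑ k ∈ Finset.range n, hx.cprodLp (k + 1 - i) (k + 1 - j) p‖ ≤ M := by
  simp only [cprodLp_eq_lagLp]
  exact hx.norm_sum_lagLp_le hM0 hM _ _ _ _

/-- The central limit theorem for absolutely summable bilinear forms in the noise. -/
theorem tendsto_cfOne_bilinear (hx : IsNoise P x) {B : ℤ × ℤ → ι × ι → ℝ}
    (hB : Summable fun q => ∑ p, |B q p|) :
    Tendsto (fun n : ℕ => cfOne P
        (((√(n : ℝ))⁻¹ • ∑ k ∈ Finset.range n,
          ∑' q : ℤ × ℤ, ∑ p, B q p • hx.cprodLp (k + 1 - q.1) (k + 1 - q.2) p) : Lp ℝ 2 P))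
      atTop (𝓝 (Complex.exp (-((‖∑' δ : ℤ, ∑ p, (∑' j : ℤ, B (j + δ, j) p) •
        hx.lagLp 0 δ p‖ ^ 2 / 2 : ℝ) : ℂ)))) := by
  obtain ⟨M, hM0, hM⟩ := hx.exists_norm_cprodLp_le
  have hB' : Summable fun q : ℤ × ℤ => ∑ p, |B (q.2 + q.1, q.2) p| :=
    (diffEquiv.summable_iff (f := fun q => ∑ p, |B q p|)).2 hB
  have hBp : ∀ p, Summable fun q : ℤ × ℤ => B (q.2 + q.1, q.2) p := fun p =>
    Summable.of_norm_bounded hB' fun q =>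
      Finset.single_le_sum (f := fun p => |B (q.2 + q.1, q.2) p|) (fun _ _ => abs_nonneg _)
        (Finset.mem_univ p)
  have hb : Summable fun δ : ℤ => ∑ p, |∑' j : ℤ, B (j + δ, j) p| := by
    refine summable_sum fun p _ => ?_
    refine Summable.of_nonneg_of_le (fun _ => abs_nonneg _) (fun δ => ?_)
      (hBp p).norm.prod
    exact norm_tsum_le_tsum_norm ((hBp p).norm.prod_factor δ)
  have h1 := hx.tendsto_cfOne_tsum_lagLp hb
  -- Moving the later time of every pair to `k + 1` merges all pairs with the same difference; only
  -- the effect of these shifts has to be estimated.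
  refine tendsto_cfOne_of_norm_sub ?_ h1
  have hlag : ∀ n : ℕ, (∑' δ : ℤ, ∑ p, (∑' j : ℤ, B (j + δ, j) p) •
      ((√(n : ℝ))⁻¹ • ∑ k ∈ Finset.range n, hx.lagLp (k + 1) δ p))
      = ∑' q : ℤ × ℤ, ∑ p, B q p •
        ((√(n : ℝ))⁻¹ • ∑ k ∈ Finset.range n, hx.lagLp (k + 1) (q.1 - q.2) p) := by
    intro n
    have hs : Summable fun q : ℤ × ℤ => ∑ p, B (q.2 + q.1, q.2) p •
        ((√(n : ℝ))⁻¹ • ∑ k ∈ Finset.range n, hx.lagLp (k + 1) q.1 p) := by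
      refine Summable.of_norm_bounded (hB'.mul_left M) fun q => norm_sum_smul_le _ fun p => ?_
      simpa using hx.norm_sum_lagLp_le hM0 hM 0 q.1 p n
    rw [← diffEquiv.tsum_eq]
    simp only [diffEquiv, Equiv.coe_fn_mk, add_sub_cancel_left]
    rw [hs.tsum_prod]
    refine tsum_congr fun δ => ?_
    dsimp only
    refine Eq.trans ?_ (Summable.tsum_finsetSum fun p _ =>
      ((hBp p).prod_factor δ).smul_const _).symm
    exact Finset.sum_congr rfl fun p _ => (((hBp p).prod_factor δ).tsum_smul_const _).symm
  have hprod : ∀ n : ℕ, ((√(n : ℝ))⁻¹ • ∑ k ∈ Finset.range n,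
      ∑' q : ℤ × ℤ, ∑ p, B q p • hx.cprodLp (k + 1 - q.1) (k + 1 - q.2) p)
      = ∑' q : ℤ × ℤ, ∑ p, B q p •
        ((√(n : ℝ))⁻¹ • ∑ k ∈ Finset.range n, hx.cprodLp (k + 1 - q.1) (k + 1 - q.2) p) := by
    intro n
    have hs : ∀ k : ℕ, Summable fun q : ℤ × ℤ =>
        ∑ p, B q p • hx.cprodLp (k + 1 - q.1) (k + 1 - q.2) p := fun k =>
      Summable.of_norm_bounded (hB.mul_left M) fun q => norm_sum_smul_le _ fun p => hM _ _ _
    rw [← Summable.tsum_finsetSum fun k _ => hs k, ← Summable.tsum_const_smul _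
      (summable_sum fun k _ => hs k)]
    refine tsum_congr fun q => ?_
    rw [Finset.sum_comm, Finset.smul_sum]
    refine Finset.sum_congr rfl fun p _ => ?_
    rw [← Finset.smul_sum, smul_comm]
  have hsum1 : ∀ n : ℕ, Summable fun q : ℤ × ℤ => ∑ p, B q p •
      ((√(n : ℝ))⁻¹ • ∑ k ∈ Finset.range n, hx.cprodLp (k + 1 - q.1) (k + 1 - q.2) p) := fun n =>
    Summable.of_norm_bounded (hB.mul_left M) fun q => norm_sum_smul_le _ fun p =>
      hx.norm_sum_cprodLp_le hM0 hM n _ _ p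
  have hsum2 : ∀ n : ℕ, Summable fun q : ℤ × ℤ => ∑ p, B q p •
      ((√(n : ℝ))⁻¹ • ∑ k ∈ Finset.range n, hx.lagLp (k + 1) (q.1 - q.2) p) := fun n =>
    Summable.of_norm_bounded (hB.mul_left M) fun q => norm_sum_smul_le _ fun p => by
      simpa using hx.norm_sum_lagLp_le hM0 hM 0 _ p n
  simp only [hlag, hprod, ← Summable.tsum_sub (hsum1 _) (hsum2 _), ← Finset.sum_sub_distrib,
    ← smul_sub]
  -- The shift error of a pair tends to zero at a rate depending on the pair, but it never exceeds
  -- 2M times the coefficients. Dominated convergence therefore needs no weighted summability.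
  refine tendsto_norm_tsum_of_dominated (hB.mul_left (2 * M)) (fun n q => ?_) fun q => ?_
  · refine norm_sum_smul_le _ fun p => ?_
    rw [Finset.sum_sub_distrib, smul_sub]
    refine (norm_sub_le _ _).trans ?_
    have h2 := hx.norm_sum_cprodLp_le hM0 hM n q.1 q.2 p
    have h3 : ‖(√(n : ℝ))⁻¹ • ∑ k ∈ Finset.range n, hx.lagLp (k + 1) (q.1 - q.2) p‖ ≤ M := by
      simpa using hx.norm_sum_lagLp_le hM0 hM 0 (q.1 - q.2) p n
    linarith
  · rw [← tendsto_zero_iff_norm_tendsto_zero]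
    have h4 : ∀ p, Tendsto (fun n : ℕ => B q p • ((√(n : ℝ))⁻¹ •
        ∑ k ∈ Finset.range n, (hx.cprodLp (k + 1 - q.1) (k + 1 - q.2) p
          - hx.lagLp (k + 1) (q.1 - q.2) p))) atTop (𝓝 0) := by
      intro p
      have h5 := tendsto_zero_iff_norm_tendsto_zero.2
        (hx.tendsto_norm_cprodLp_sub_lagLp q.1 q.2 p)
      simpa [smul_sub, Finset.sum_sub_distrib] using h5.const_smul (B q p)
    simpa using tendsto_finsetSum Finset.univ fun p _ => h4 p

end IsNoise


/-! ### Coefficient matrices and convergence of the series in V -/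

section Coefficients

variable {m : ℕ} {C : ℤ → Matrix (Fin m) (Fin m) ℝ}

lemma abs_apply_le_opNorm (A : Matrix (Fin m) (Fin m) ℝ) (α a : Fin m) : |A α a| ≤ opNorm A := by
  have h1 : A α a = (Matrix.toEuclideanCLM (n := Fin m) (𝕜 := ℝ) A
      (EuclideanSpace.single a 1)).ofLp α := by
    rw [Matrix.ofLp_toEuclideanCLM]
    simp
  rw [h1, ← Real.norm_eq_abs]
  refine (PiLp.norm_apply_le _ α).trans ((ContinuousLinearMap.le_opNorm _ _).trans ?_)
  simp [opNorm]

lemma summable_entry (hCneg : ∀ j : ℤ, j < 0 → C j = 0)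
    (hCabs : Summable fun j : ℕ => opNorm (C j)) (α a : Fin m) :
    Summable fun j : ℤ => C j α a := by
  refine (Function.Injective.summable_iff (g := fun j : ℕ => (j : ℤ)) Nat.cast_injective
    fun j hj => ?_).1 (Summable.of_norm_bounded hCabs fun j => abs_apply_le_opNorm _ _ _)
  rw [hCneg j (by_contra fun h => hj ⟨j.toNat, by simpa using h⟩), Matrix.zero_apply]

lemma summable_matrix_iff {κ n n' : Type*} {f : κ → Matrix n n' ℝ} :
    Summable f ↔ ∀ i j, Summable fun k => f k i j :=
  Pi.summable.trans (forall_congr' fun _ => Pi.summable)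

lemma matrix_tsum_apply {κ n n' : Type*} {f : κ → Matrix n n' ℝ} (hf : Summable f) (i : n)
    (j : n') : (∑' k, f k) i j = ∑' k, f k i j := by
  have h1 := tsum_apply (f := fun k => (f k : n → n' → ℝ)) hf (x := i)
  have h2 := tsum_apply (Pi.summable.1 hf i) (x := j)
  exact (congrFun h1 j).trans h2

lemma summable_mul_pair {κ κ' : Type*} {f : κ → ℝ} {g : κ' → ℝ} (hf : Summable f)
    (hg : Summable g) : Summable fun q : κ × κ' => f q.1 * g q.2 :=
  summable_mul_of_summable_norm hf.norm hg.norm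

lemma summable_mul_same {κ : Type*} {f g : κ → ℝ} (hf : Summable f) (hg : Summable g) :
    Summable fun k => f k * g k :=
  (summable_mul_pair hf hg).comp_injective (i := fun k => (k, k)) fun _ _ h => (Prod.ext_iff.1 h).1

/-- The series `∑ j, C_{j+δ} ⊗ C_j` over all integers. -/
noncomputable def sigmaInt (C : ℤ → Matrix (Fin m) (Fin m) ℝ) (δ : ℤ) :
    Matrix (Fin m × Fin m) (Fin m × Fin m) ℝ :=
  ∑' j : ℤ, C (j + δ) ⊗ₖ C j

lemma summable_shift (hC : ∀ α a, Summable fun j : ℤ => C j α a) (δ : ℤ) (α a : Fin m) :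
    Summable fun j : ℤ => C (j + δ) α a :=
  (Equiv.addRight δ).summable_iff.2 (hC α a)

lemma summable_kron_int (hC : ∀ α a, Summable fun j : ℤ => C j α a) (δ : ℤ) :
    Summable fun j : ℤ => C (j + δ) ⊗ₖ C j :=
  summable_matrix_iff.2 fun i j => summable_mul_same (summable_shift hC δ i.1 j.1) (hC i.2 j.2)

lemma sigmaInt_apply (hC : ∀ α a, Summable fun j : ℤ => C j α a) (δ : ℤ) (i j : Fin m × Fin m) :
    sigmaInt C δ i j = ∑' k : ℤ, C (k + δ) i.1 j.1 * C k i.2 j.2 :=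
  matrix_tsum_apply (summable_kron_int hC δ) i j

/-- A correlation of two absolutely summable sequences is absolutely summable: reindex the double
series of products by the difference of the indices. -/
lemma summable_sigmaInt (hC : ∀ α a, Summable fun j : ℤ => C j α a) (i j : Fin m × Fin m) :
    Summable fun δ : ℤ => sigmaInt C δ i j := by
  have h : Summable fun q : ℤ × ℤ => C (q.2 + q.1) i.1 j.1 * C q.2 i.2 j.2 :=
    (diffEquiv_summable (f := fun q => C q.1 i.1 j.1 * C q.2 i.2 j.2)).2
      (summable_mul_pair (hC i.1 j.1) (hC i.2 j.2))
  simpa only [sigmaInt_apply hC] using h.prod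
where
  diffEquiv_summable {f : ℤ × ℤ → ℝ} :
      (Summable fun q : ℤ × ℤ => f (q.2 + q.1, q.2)) ↔ Summable f :=
    IsNoise.diffEquiv.summable_iff

lemma natCast_range_of_ne_zero (hCneg : ∀ j : ℤ, j < 0 → C j = 0) {j : ℤ} (h : C j ≠ 0) :
    j ∈ Set.range fun j : ℕ => (j : ℤ) :=
  ⟨j.toNat, by simpa using le_of_not_gt fun hj => h (hCneg j hj)⟩

lemma sigmaSum_eq (hCneg : ∀ j : ℤ, j < 0 → C j = 0) (r : ℤ) : sigmaSum C r = sigmaInt C r :=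
  Function.Injective.tsum_eq (g := fun j : ℕ => (j : ℤ)) Nat.cast_injective
    (f := fun j : ℤ => C (j + r) ⊗ₖ C j) fun j hj => natCast_range_of_ne_zero hCneg fun h => hj (by
      simp [h])

/-- Shift the summation index by r. Both families of the statement become values of one function on
ℤ, matching the lags δ and −δ of the bilinear form. -/
lemma sigmaStarSum_eq (hCneg : ∀ j : ℤ, j < 0 → C j = 0) (r : ℤ) :
    sigmaStarSum C r = sigmaInt C (-r) := by
  have h1 : sigmaStarSum C r = ∑' j : ℤ, C j ⊗ₖ C (j + r) :=
    Function.Injective.tsum_eq (g := fun j : ℕ => (j : ℤ)) Nat.cast_injective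
      (f := fun j : ℤ => C j ⊗ₖ C (j + r)) fun j hj =>
        natCast_range_of_ne_zero hCneg fun h => hj (by simp [h])
  rw [h1, sigmaInt, ← (Equiv.addRight r).tsum_eq fun j : ℤ => C (j + -r) ⊗ₖ C j]
  simp

lemma summable_sigmaSum_kron (hC : ∀ α a, Summable fun j : ℤ => C j α a) (r : ℤ) :
    Summable fun j : ℕ => C (j + r) ⊗ₖ C j :=
  (summable_kron_int hC r).comp_injective (i := fun j : ℕ => (j : ℤ)) Nat.cast_injective

lemma summable_sigmaStarSum_kron (hC : ∀ α a, Summable fun j : ℤ => C j α a) (r : ℤ) :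
    Summable fun j : ℕ => C j ⊗ₖ C (j + r) :=
  summable_matrix_iff.2 fun i j => (summable_mul_same (hC i.1 j.1)
    (summable_shift hC r i.2 j.2)).comp_injective (i := fun j : ℕ => (j : ℤ)) Nat.cast_injective

lemma summable_mul_mul_transpose {n : Type*} [Fintype n] {F G : ℕ → Matrix n n ℝ}
    (hF : ∀ i j, Summable fun r => F r i j) (hG : ∀ i j, Summable fun r => G r i j)
    (K : Matrix n n ℝ) : Summable fun r => F r * K * (G r)ᵀ := by
  refine summable_matrix_iff.2 fun i j => ?_
  simp only [Matrix.mul_apply, Matrix.transpose_apply, Finset.sum_mul]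
  exact summable_sum fun y _ => summable_sum fun z _ =>
    summable_mul_same ((hF i z).mul_right _) (hG j y)

lemma summable_sigmaSum (hCneg : ∀ j : ℤ, j < 0 → C j = 0)
    (hC : ∀ α a, Summable fun j : ℤ => C j α a) (h : ℤ) (i j : Fin m × Fin m) :
    Summable fun r : ℕ => sigmaSum C ((r : ℤ) + 1 + h) i j := by
  simp only [sigmaSum_eq hCneg]
  exact (summable_sigmaInt hC i j).comp_injective (i := fun r : ℕ => (r : ℤ) + 1 + h)
    fun a b hab => by simpa using hab

lemma summable_sigmaStarSum (hCneg : ∀ j : ℤ, j < 0 → C j = 0)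
    (hC : ∀ α a, Summable fun j : ℤ => C j α a) (h : ℤ) (i j : Fin m × Fin m) :
    Summable fun r : ℕ => sigmaStarSum C ((r : ℤ) + 1 - h) i j := by
  simp only [sigmaStarSum_eq hCneg]
  exact (summable_sigmaInt hC i j).comp_injective (i := fun r : ℕ => -((r : ℤ) + 1 - h))
    fun a b hab => by simpa using hab

lemma summable_diagTerm (hCneg : ∀ j : ℤ, j < 0 → C j = 0)
    (hC : ∀ α a, Summable fun j : ℤ => C j α a) (S : Matrix (Fin m) (Fin m) ℝ) (h : ℤ) :
    Summable fun r : ℕ => diagTerm C S h (r + 1) :=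
  (summable_mul_mul_transpose (summable_sigmaSum hCneg hC h) (summable_sigmaSum hCneg hC h) _).add
    (summable_mul_mul_transpose (summable_sigmaStarSum hCneg hC h)
      (summable_sigmaStarSum hCneg hC h) _)

lemma crossTerm_eq (A : Matrix (Fin m) (Fin m) ℝ) (h r : ℤ) :
    crossTerm C A h r
      = sigmaSum C (r + h) * ((A ⊗ₖ A) * kronPerm m * (Aᵀ ⊗ₖ Aᵀ)) * (sigmaStarSum C (r - h))ᵀ
        + sigmaStarSum C (r - h) * ((A ⊗ₖ A) * kronPerm m * (Aᵀ ⊗ₖ Aᵀ)) * (sigmaSum C (r + h))ᵀ := by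
  simp only [crossTerm, Matrix.mul_assoc]

lemma summable_crossTerm (hCneg : ∀ j : ℤ, j < 0 → C j = 0)
    (hC : ∀ α a, Summable fun j : ℤ => C j α a) (A : Matrix (Fin m) (Fin m) ℝ) (h : ℤ) :
    Summable fun r : ℕ => crossTerm C A h (r + 1) := by
  simp only [crossTerm_eq]
  exact (summable_mul_mul_transpose (summable_sigmaSum hCneg hC h)
    (summable_sigmaStarSum hCneg hC h) _).add
    (summable_mul_mul_transpose (summable_sigmaStarSum hCneg hC h)
      (summable_sigmaSum hCneg hC h) _)

lemma kronPerm_apply (i j : Fin m × Fin m) :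
    kronPerm m i j = if i.1 = j.2 ∧ i.2 = j.1 then 1 else 0 := by
  simp only [kronPerm, Matrix.sum_apply, Matrix.kroneckerMap_apply, Matrix.single_apply]
  rw [Finset.sum_eq_single i.1, Finset.sum_eq_single j.1]
  · by_cases h1 : i.1 = j.2 <;> by_cases h2 : i.2 = j.1 <;> simp [h1, h2, Ne.symm]

  · intro b _ hb; simp [hb]
  · simp
  · intro b _ hb; exact Finset.sum_eq_zero fun c _ => by simp [hb]
  · simp

/-- The root enters only through A Aᵀ, so its choice is immaterial, and the entries are the
covariances of products with exchanged times. -/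
lemma kron_kronPerm_kron_apply (A : Matrix (Fin m) (Fin m) ℝ) (i j : Fin m × Fin m) :
    ((A ⊗ₖ A) * kronPerm m * (Aᵀ ⊗ₖ Aᵀ)) i j = (A * Aᵀ) i.1 j.2 * (A * Aᵀ) i.2 j.1 := by
  have h1 : ∀ q : Fin m × Fin m, ((A ⊗ₖ A) * kronPerm m) i q = A i.1 q.2 * A i.2 q.1 := by
    intro q
    rw [Matrix.mul_apply, Finset.sum_eq_single (q.2, q.1)]
    · simp [kronPerm_apply]
    · intro b _ hb
      rw [kronPerm_apply, if_neg, mul_zero]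
      exact fun h => hb (Prod.ext h.1 h.2)
    · simp
  rw [Matrix.mul_apply]
  simp only [h1, Matrix.kroneckerMap_apply, Matrix.transpose_apply]
  rw [Matrix.mul_apply, Matrix.mul_apply, Finset.sum_mul_sum, Fintype.sum_prod_type,
    Finset.sum_comm]
  refine Finset.sum_congr rfl fun a _ => Finset.sum_congr rfl fun b _ => ?_
  simp only [Matrix.transpose_apply]
  ring

/-- The coefficient of `ξ_{k-i} ⊗ ξ_{k-j}` in `⟨t, Y_{k+h} ⊗ Y_k⟩`. -/
noncomputable def bilinCoeff (C : ℤ → Matrix (Fin m) (Fin m) ℝ) (h : ℤ) (t : Fin m × Fin m → ℝ)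
    (q : ℤ × ℤ) (p : Fin m × Fin m) : ℝ :=
  ∑ r : Fin m × Fin m, t r * (C (q.1 + h) r.1 p.1 * C q.2 r.2 p.2)

lemma summable_bilinCoeff (hC : ∀ α a, Summable fun j : ℤ => C j α a) (h : ℤ)
    (t : Fin m × Fin m → ℝ) : Summable fun q => ∑ p, |bilinCoeff C h t q p| :=
  summable_sum fun _ _ => Summable.norm <| summable_sum fun _ _ =>
    (summable_mul_pair (summable_shift hC h _ _) (hC _ _)).mul_left _

/-- Collects the coefficients along the diagonal i − j = δ; the lag h in Y_{k+h} shifts the diagonal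
to δ + h. -/
lemma tsum_bilinCoeff (hC : ∀ α a, Summable fun j : ℤ => C j α a) (h δ : ℤ)
    (t : Fin m × Fin m → ℝ) (p : Fin m × Fin m) :
    ∑' j : ℤ, bilinCoeff C h t (j + δ, j) p = ((sigmaInt C (δ + h))ᵀ *ᵥ t) p := by
  have hs : ∀ r : Fin m × Fin m, Summable fun j : ℤ =>
      t r * (C (j + δ + h) r.1 p.1 * C j r.2 p.2) := fun r => by
    simpa only [add_assoc] using
      (summable_mul_same (summable_shift hC (δ + h) _ _) (hC _ _)).mul_left (t r)
  simp only [bilinCoeff]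
  rw [Summable.tsum_finsetSum fun r _ => hs r, Matrix.mulVec, dotProduct]
  refine Finset.sum_congr rfl fun r _ => ?_
  rw [tsum_mul_left, Matrix.transpose_apply, sigmaInt_apply hC, mul_comm]
  simp only [add_assoc]

end Coefficients

/-! ### Identification of the limiting variance -/

section Variance

variable {Ω : Type*} [MeasurableSpace Ω] {P : Measure Ω} [IsProbabilityMeasure P] {m : ℕ}
  {x : ℤ → Ω → Fin m → ℝ} {C : ℤ → Matrix (Fin m) (Fin m) ℝ}

lemma inner_sum_sum_eq {n H : Type*} [Fintype n] [NormedAddCommGroup H] [InnerProductSpace ℝ H]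
    {f g : n → H} {K : Matrix n n ℝ} (h : ∀ p p', ⟪f p, g p'⟫_ℝ = K p p') (b c : n → ℝ) :
    ⟪∑ p, b p • f p, ∑ p, c p • g p⟫_ℝ = b ⬝ᵥ K *ᵥ c := by
  simp only [sum_inner, inner_sum, inner_smul_left, inner_smul_right, h, dotProduct, Matrix.mulVec,
    Finset.mul_sum]
  rw [Finset.sum_comm]
  refine Finset.sum_congr rfl fun p _ => Finset.sum_congr rfl fun q _ => ?_
  simp only [conj_trivial]
  ring

lemma dotProduct_mul_mul_transpose {n : Type*} [Fintype n] (F K G : Matrix n n ℝ) (t : n → ℝ) :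
    t ⬝ᵥ (F * K * Gᵀ) *ᵥ t = (Fᵀ *ᵥ t) ⬝ᵥ K *ᵥ (Gᵀ *ᵥ t) := by
  rw [Matrix.mul_assoc, ← Matrix.mulVec_mulVec, ← Matrix.mulVec_mulVec, Matrix.dotProduct_mulVec,
    ← Matrix.mulVec_transpose]

lemma inner_tsum_eq_pair {H : Type*} [NormedAddCommGroup H] [InnerProductSpace ℝ H]
    {f : ℤ → H} (hf : Summable f) (h : ∀ δ δ', δ ≠ δ' → δ ≠ -δ' → ⟪f δ, f δ'⟫_ℝ = 0) {δ : ℤ}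
    (hδ : δ ≠ 0) : ⟪f δ, ∑' δ', f δ'⟫_ℝ = ‖f δ‖ ^ 2 + ⟪f δ, f (-δ)⟫_ℝ := by
  have h1 : ⟪f δ, ∑' δ', f δ'⟫_ℝ = ∑' δ', ⟪f δ, f δ'⟫_ℝ := (innerSL ℝ (f δ)).map_tsum hf
  rw [h1, tsum_eq_sum (s := {δ, -δ}), Finset.sum_pair (by omega), real_inner_self_eq_norm_sq]
  intro δ' hδ'
  simp only [Finset.mem_insert, Finset.mem_singleton, not_or] at hδ'
  exact h _ _ (Ne.symm hδ'.1) (by omega)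

lemma inner_zero_tsum_eq {H : Type*} [NormedAddCommGroup H] [InnerProductSpace ℝ H]
    {f : ℤ → H} (hf : Summable f) (h : ∀ δ δ', δ ≠ δ' → δ ≠ -δ' → ⟪f δ, f δ'⟫_ℝ = 0) :
    ⟪f 0, ∑' δ', f δ'⟫_ℝ = ‖f 0‖ ^ 2 := by
  have h1 : ⟪f 0, ∑' δ', f δ'⟫_ℝ = ∑' δ', ⟪f 0, f δ'⟫_ℝ := (innerSL ℝ (f 0)).map_tsum hf
  rw [h1, tsum_eq_single 0, real_inner_self_eq_norm_sq]
  intro δ' hδ'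
  exact h 0 δ' hδ'.symm (by omega)

/-- Pair the full sum with each summand: f δ meets only itself and f (−δ). Grouping δ = r + 1 with
−(r + 1) counts the mixed inner product twice. -/
lemma norm_sq_tsum_int {H : Type*} [NormedAddCommGroup H] [InnerProductSpace ℝ H]
    {f : ℤ → H} (hf : Summable f)
    (h : ∀ δ δ', δ ≠ δ' → δ ≠ -δ' → ⟪f δ, f δ'⟫_ℝ = 0) :
    ‖∑' δ, f δ‖ ^ 2 = ‖f 0‖ ^ 2 + ∑' r : ℕ, (‖f (r + 1)‖ ^ 2 + ‖f (-(r + 1))‖ ^ 2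
      + 2 * ⟪f (r + 1), f (-(r + 1))⟫_ℝ) := by
  obtain ⟨Z, hZ⟩ : ∃ Z, Z = ∑' δ, f δ := ⟨_, rfl⟩
  have hs : Summable fun δ => ⟪Z, f δ⟫_ℝ := hf.mapL (innerSL ℝ Z)
  have h1 : ⟪Z, ∑' δ, f δ⟫_ℝ = ∑' δ, ⟪Z, f δ⟫_ℝ := (innerSL ℝ Z).map_tsum hf
  have hs1 : Summable fun r : ℕ => ⟪Z, f ((r : ℤ) + 1)⟫_ℝ :=
    hs.comp_injective (i := fun r : ℕ => (r : ℤ) + 1) fun a b hab => by simpa using hab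
  have hs2 : Summable fun r : ℕ => ⟪Z, f (-((r : ℤ) + 1))⟫_ℝ :=
    hs.comp_injective (i := fun r : ℕ => -((r : ℤ) + 1)) fun a b hab => by simpa using hab
  have h2 := tsum_of_add_one_of_neg_add_one (f := fun δ : ℤ => ⟪Z, f δ⟫_ℝ) hs1 hs2
  rw [← h1, ← hZ, real_inner_self_eq_norm_sq] at h2
  have h0 : ⟪Z, f 0⟫_ℝ = ‖f 0‖ ^ 2 := by
    rw [real_inner_comm, hZ, inner_zero_tsum_eq hf h]
  have h3 : ∀ δ, δ ≠ 0 → ⟪Z, f δ⟫_ℝ = ‖f δ‖ ^ 2 + ⟪f δ, f (-δ)⟫_ℝ := fun δ hδ => by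
    rw [real_inner_comm, hZ, inner_tsum_eq_pair hf h hδ]
  rw [← hZ, h2, h0, add_comm (∑' r : ℕ, _), add_assoc, ← hs1.tsum_add hs2]
  congr 1
  refine tsum_congr fun r => ?_
  rw [h3 _ (by omega), h3 _ (by omega), neg_neg, real_inner_comm (f ((r : ℤ) + 1))]
  ring

lemma hasSum_quadratic {κ n : Type*} [Fintype n] {f : κ → Matrix n n ℝ} {K : Matrix n n ℝ}
    (hf : HasSum f K) (t : n → ℝ) : HasSum (fun k => t ⬝ᵥ f k *ᵥ t) (t ⬝ᵥ K *ᵥ t) := by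
  have h : ∀ i j, HasSum (fun k => f k i j) (K i j) := fun i j =>
    Pi.hasSum.1 (Pi.hasSum.1 hf i) j
  simp only [dotProduct, Matrix.mulVec]
  exact hasSum_sum fun i _ => (hasSum_sum fun j _ => (h i j).mul_right _).mul_left _

namespace IsNoise

/-- The `L²` limit whose variance is the quadratic form of the asymptotic covariance matrix. -/
noncomputable def limitLp (hx : IsNoise P x) (C : ℤ → Matrix (Fin m) (Fin m) ℝ) (h : ℤ)
    (t : Fin m × Fin m → ℝ) : Lp ℝ 2 P :=
  ∑' δ : ℤ, ∑ p, ((sigmaInt C (δ + h))ᵀ *ᵥ t) p • hx.lagLp 0 δ p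

lemma summable_limitLp (hx : IsNoise P x) (hC : ∀ α a, Summable fun j : ℤ => C j α a) (h : ℤ)
    (t : Fin m × Fin m → ℝ) :
    Summable fun δ : ℤ => ∑ p, ((sigmaInt C (δ + h))ᵀ *ᵥ t) p • hx.lagLp 0 δ p := by
  obtain ⟨M, hM0, hM⟩ := hx.exists_norm_cprodLp_le
  have hb : Summable fun δ : ℤ => ∑ p, |((sigmaInt C (δ + h))ᵀ *ᵥ t) p| := by
    refine summable_sum fun p _ => Summable.abs ?_
    simp only [Matrix.mulVec, dotProduct, Matrix.transpose_apply]
    exact summable_sum fun r _ => ((Equiv.addRight h).summable_iff.2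
      (summable_sigmaInt hC r p)).mul_right (t r)
  exact Summable.of_norm_bounded (hb.mul_left M) fun δ => norm_sum_smul_le _ fun p => hM _ _ _

/-- Of the double sum over lags only δ' = ±δ survives. Lag 0 has Gram matrix Υ*, each nonzero lag
has Σ_ξ ⊗ Σ_ξ, and opposite lags have the matrix `K` with P_{m,m}. -/
lemma norm_sq_limitLp (hx : IsNoise P x) (hCneg : ∀ j : ℤ, j < 0 → C j = 0)
    (hC : ∀ α a, Summable fun j : ℤ => C j α a) (U : Matrix (Fin m × Fin m) (Fin m × Fin m) ℝ)
    (S A : Matrix (Fin m) (Fin m) ℝ)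
    (hU : ∀ p p', U p p' = ∫ ω, (x 1 ω p.1 * x 1 ω p.2) * (x 1 ω p'.1 * x 1 ω p'.2) ∂P
        - (∫ ω, x 1 ω p.1 * x 1 ω p.2 ∂P) * ∫ ω, x 1 ω p'.1 * x 1 ω p'.2 ∂P)
    (hS : ∀ a b, S a b = ∫ ω, x 1 ω a * x 1 ω b ∂P) (hA : S = A * Aᵀ) (h : ℤ)
    (t : Fin m × Fin m → ℝ) :
    ‖hx.limitLp C h t‖ ^ 2 = t ⬝ᵥ limitCov C U S A h *ᵥ t := by
  set K := (A ⊗ₖ A) * kronPerm m * (Aᵀ ⊗ₖ Aᵀ) with hK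
  have hVt : t ⬝ᵥ limitCov C U S A h *ᵥ t = t ⬝ᵥ (sigmaSum C h * U * (sigmaSum C h)ᵀ) *ᵥ t
      + ∑' r : ℕ, (t ⬝ᵥ diagTerm C S h (r + 1) *ᵥ t + t ⬝ᵥ crossTerm C A h (r + 1) *ᵥ t) := by
    have hd := summable_diagTerm hCneg hC S h
    have hc := summable_crossTerm hCneg hC A h
    have h3 := ((hasSum_quadratic hd.hasSum t).add (hasSum_quadratic hc.hasSum t)).tsum_eq
    rw [limitCov, Matrix.add_mulVec, Matrix.add_mulVec, dotProduct_add, dotProduct_add, h3,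
      add_assoc]
  have horth : ∀ δ δ' : ℤ, δ ≠ δ' → δ ≠ -δ' →
      ⟪∑ p, ((sigmaInt C (δ + h))ᵀ *ᵥ t) p • hx.lagLp 0 δ p,
        ∑ p, ((sigmaInt C (δ' + h))ᵀ *ᵥ t) p • hx.lagLp 0 δ' p⟫_ℝ = 0 := by
    intro δ δ' h1 h2
    rw [inner_sum_sum_eq (K := 0) fun p p' => by
      rw [hx.inner_lagLp_eq_zero_of_lag 0 h1 h2]; rfl]
    simp
  rw [limitLp, norm_sq_tsum_int (hx.summable_limitLp hC h t) horth, hVt]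
  congr 1
  · rw [← real_inner_self_eq_norm_sq, inner_sum_sum_eq (K := U), dotProduct_mul_mul_transpose,
      sigmaSum_eq hCneg, zero_add]
    intro p p'
    simp only [lagLp, neg_zero, max_self, sub_zero]
    rw [hx.inner_cprodLp_diag, hU]
  · refine tsum_congr fun r => ?_
    have e1 : max ((r : ℤ) + 1) 0 = r + 1 := by omega
    have e2 : max (-((r : ℤ) + 1)) 0 = 0 := by omega
    have hne : (0 : ℤ) - (r + 1) ≠ 0 - 0 := by omega
    have hKp : ∀ p p', K p p' = S p.1 p'.2 * S p.2 p'.1 := fun p p' => by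
      rw [hK, kron_kronPerm_kron_apply, hA]
    have hKt : Kᵀ = K := by
      ext p p'
      have hsym : ∀ a b, S a b = S b a := fun a b => by simp only [hS, mul_comm]
      rw [Matrix.transpose_apply, hKp, hKp, hsym p'.1, hsym p'.2, mul_comm]
    have i1 : ∀ p p', ⟪hx.lagLp 0 ((r : ℤ) + 1) p, hx.lagLp 0 ((r : ℤ) + 1) p'⟫_ℝ
        = (S ⊗ₖ S) p p' := fun p p' => by
      simp only [lagLp, e1, e2]
      rw [hx.inner_cprodLp_same hne, Matrix.kroneckerMap_apply, hS, hS]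
    have i2 : ∀ p p', ⟪hx.lagLp 0 (-((r : ℤ) + 1)) p, hx.lagLp 0 (-((r : ℤ) + 1)) p'⟫_ℝ
        = (S ⊗ₖ S) p p' := fun p p' => by
      simp only [lagLp, e1, e2, neg_neg]
      rw [hx.inner_cprodLp_same hne.symm, Matrix.kroneckerMap_apply, hS, hS]
    have i3 : ∀ p p', ⟪hx.lagLp 0 ((r : ℤ) + 1) p, hx.lagLp 0 (-((r : ℤ) + 1)) p'⟫_ℝ
        = K p p' := fun p p' => by
      simp only [lagLp, e1, e2, neg_neg]
      rw [hx.inner_cprodLp_swap hne, hKp, hS, hS]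
    have e3 : -((r : ℤ) + 1) + h = -((r : ℤ) + 1 - h) := by ring
    rw [← real_inner_self_eq_norm_sq, ← real_inner_self_eq_norm_sq, inner_sum_sum_eq i1,
      inner_sum_sum_eq i2, inner_sum_sum_eq i3, diagTerm, crossTerm_eq, ← hK, Matrix.add_mulVec,
      Matrix.add_mulVec, dotProduct_add, dotProduct_add, dotProduct_mul_mul_transpose,
      dotProduct_mul_mul_transpose, dotProduct_mul_mul_transpose, dotProduct_mul_mul_transpose,
      sigmaSum_eq hCneg, sigmaStarSum_eq hCneg, e3]
    set b := (sigmaInt C ((r : ℤ) + 1 + h))ᵀ *ᵥ t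
    set c := (sigmaInt C (-((r : ℤ) + 1 - h)))ᵀ *ᵥ t
    -- Symmetry of `K` makes the two summands of the cross term equal as quadratic forms, which
    -- accounts for the factor 2.
    have hsymm : c ⬝ᵥ K *ᵥ b = b ⬝ᵥ K *ᵥ c := by
      rw [Matrix.dotProduct_mulVec, ← Matrix.mulVec_transpose, hKt, dotProduct_comm]
    rw [hsymm]
    ring

end IsNoise

lemma limitCov_transpose {U : Matrix (Fin m × Fin m) (Fin m × Fin m) ℝ}
    {S A : Matrix (Fin m) (Fin m) ℝ} (hU : Uᵀ = U) (hA : S = A * Aᵀ) (h : ℤ) :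
    (limitCov C U S A h)ᵀ = limitCov C U S A h := by
  have hS : Sᵀ = S := by rw [hA]; simp
  have hSS : (S ⊗ₖ S)ᵀ = S ⊗ₖ S := by rw [← Matrix.kroneckerMap_transpose, hS]
  have hK : ((A ⊗ₖ A) * kronPerm m * (Aᵀ ⊗ₖ Aᵀ))ᵀ = (A ⊗ₖ A) * kronPerm m * (Aᵀ ⊗ₖ Aᵀ) := by
    ext p p'
    have hsym : ∀ a b, (A * Aᵀ) a b = (A * Aᵀ) b a := fun a b => by
      rw [← hA]; exact congrFun (congrFun hS b) a
    rw [Matrix.transpose_apply, kron_kronPerm_kron_apply, kron_kronPerm_kron_apply, hsym p'.1,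
      hsym p'.2, mul_comm]
  rw [limitCov, Matrix.transpose_add, Matrix.transpose_add, Matrix.transpose_tsum,
    Matrix.transpose_tsum]
  congr 1
  · congr 1
    · simp only [Matrix.transpose_mul, Matrix.transpose_transpose, hU, Matrix.mul_assoc]
    · refine tsum_congr fun r => ?_
      simp only [diagTerm, Matrix.transpose_add, Matrix.transpose_mul, Matrix.transpose_transpose,
        hSS, Matrix.mul_assoc]
  · refine tsum_congr fun r => ?_
    rw [crossTerm_eq, Matrix.transpose_add, Matrix.transpose_mul, Matrix.transpose_mul,
      Matrix.transpose_mul (sigmaStarSum C _ * _), Matrix.transpose_mul (sigmaStarSum C _), hK,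
      Matrix.transpose_transpose, Matrix.transpose_transpose, add_comm]
    simp only [Matrix.mul_assoc]

end Variance


/-! ### L¹ estimates -/

section LOneBound

variable {Ω : Type*} [MeasurableSpace Ω] {P : Measure Ω}

/-- `f` is integrable, with `E|f| ≤ c`. -/
def L1Bound (P : Measure Ω) (f : Ω → ℝ) (c : ℝ) : Prop :=
  Integrable f P ∧ ∫ ω, |f ω| ∂P ≤ c

namespace L1Bound

variable {f g : Ω → ℝ} {c d : ℝ}

lemma congr (hf : L1Bound P f c) (h : f =ᵐ[P] g) : L1Bound P g c :=
  ⟨hf.1.congr h, (integral_congr_ae (h.mono fun ω hω => by simp only [hω])).symm.trans_le hf.2⟩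

lemma add (hf : L1Bound P f c) (hg : L1Bound P g d) : L1Bound P (fun ω => f ω + g ω) (c + d) := by
  refine ⟨hf.1.add hg.1, ?_⟩
  calc ∫ ω, |f ω + g ω| ∂P ≤ ∫ ω, (|f ω| + |g ω|) ∂P :=
        integral_mono (hf.1.add hg.1).abs (hf.1.abs.add hg.1.abs) fun ω => abs_add_le _ _
    _ = ∫ ω, |f ω| ∂P + ∫ ω, |g ω| ∂P := integral_add hf.1.abs hg.1.abs
    _ ≤ c + d := add_le_add hf.2 hg.2

lemma const_mul (hf : L1Bound P f c) (a : ℝ) : L1Bound P (fun ω => a * f ω) (|a| * c) := by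
  refine ⟨hf.1.const_mul a, ?_⟩
  simp only [abs_mul, integral_const_mul]
  exact mul_le_mul_of_nonneg_left hf.2 (abs_nonneg a)

lemma sub (hf : L1Bound P f c) (hg : L1Bound P g d) : L1Bound P (fun ω => f ω - g ω) (c + d) := by
  simpa [sub_eq_add_neg] using hf.add (hg.const_mul (-1))

lemma mono (hf : L1Bound P f c) (h : c ≤ d) : L1Bound P f d := ⟨hf.1, hf.2.trans h⟩

lemma sum {κ : Type*} {s : Finset κ} {f : κ → Ω → ℝ} {c : κ → ℝ}
    (h : ∀ i ∈ s, L1Bound P (f i) (c i)) :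
    L1Bound P (fun ω => ∑ i ∈ s, f i ω) (∑ i ∈ s, c i) := by
  refine ⟨integrable_finsetSum s fun i hi => (h i hi).1, ?_⟩
  calc ∫ ω, |∑ i ∈ s, f i ω| ∂P ≤ ∫ ω, ∑ i ∈ s, |f i ω| ∂P :=
        integral_mono (integrable_finsetSum s fun i hi => (h i hi).1).abs
          (integrable_finsetSum s fun i hi => (h i hi).1.abs) fun ω => Finset.abs_sum_le_sum_abs _ _
    _ = ∑ i ∈ s, ∫ ω, |f i ω| ∂P := integral_finsetSum s fun i hi => (h i hi).1.abs
    _ ≤ ∑ i ∈ s, c i := Finset.sum_le_sum fun i hi => (h i hi).2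

/-- Cauchy–Schwarz, applied to |F| and |G|. -/
lemma mul (F G : Lp ℝ 2 P) (hF : F =ᵐ[P] f) (hG : G =ᵐ[P] g) (hc : ‖F‖ ≤ c) (hd : ‖G‖ ≤ d) :
    L1Bound P (fun ω => f ω * g ω) (c * d) := by
  have hc0 : 0 ≤ c := (norm_nonneg F).trans hc
  refine L1Bound.congr (f := fun ω => F ω * G ω) ?_ (hF.mul hG)
  have hint : Integrable (fun ω => F ω * G ω) P := (Lp.memLp F).integrable_mul (Lp.memLp G)
  refine ⟨hint, ?_⟩
  have h1 : ∫ ω, |F ω * G ω| ∂P = ⟪|F|, |G|⟫_ℝ := by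
    rw [L2.inner_def]
    refine integral_congr_ae ?_
    filter_upwards [Lp.coeFn_abs F, Lp.coeFn_abs G] with ω h1 h2
    rw [h1, h2, abs_mul]
    simp [mul_comm]
  rw [h1]
  refine (real_inner_le_norm _ _).trans ?_
  rw [norm_abs_eq_norm, norm_abs_eq_norm]
  exact mul_le_mul hc hd (norm_nonneg _) hc0

end L1Bound

end LOneBound

/-- The difference between the normalized sample autocovariance and the normalized sum of
centred lagged products, for a single pair of coordinates. -/
lemma sampleAutocov_sub_eq (u v : ℤ → ℝ) {h n : ℕ} (hn0 : 0 < n) (g : ℝ) :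
    √(n : ℝ) * ((n : ℝ)⁻¹ * ∑ k ∈ Finset.Icc 1 (n - h),
        (u k - (n : ℝ)⁻¹ * ∑ k ∈ Finset.Icc 1 n, u k)
          * (v (k + h) - (n : ℝ)⁻¹ * ∑ k ∈ Finset.Icc 1 n, v k) - g)
      - (√(n : ℝ))⁻¹ * ∑ k ∈ Finset.range n, (v (k + 1 + h) * u (k + 1) - g)
    = (√(n : ℝ))⁻¹ * (((n - h : ℕ) * (n : ℝ)⁻¹ * (n : ℝ)⁻¹)
          * ((∑ k ∈ Finset.Icc 1 n, u k) * ∑ k ∈ Finset.Icc 1 n, v k)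
        - (n : ℝ)⁻¹ * ((∑ k ∈ Finset.Icc 1 (n - h), u k) * ∑ k ∈ Finset.Icc 1 n, v k)
        - (n : ℝ)⁻¹ * ((∑ k ∈ Finset.Icc 1 n, u k) * ∑ k ∈ Finset.Icc 1 (n - h), v (k + h))
        - ∑ k ∈ Finset.Icc 1 n \ Finset.Icc 1 (n - h), v (k + h) * u k) := by
  have hnr : (0 : ℝ) < n := by exact_mod_cast hn0
  have hs := Real.sqrt_pos.2 hnr
  have h1 : ∑ k ∈ Finset.range n, (v (k + 1 + h) * u (k + 1) - g)
      = ∑ k ∈ Finset.Icc 1 n, v (k + h) * u k - n * g := by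
    have h2 := Finset.sum_Ico_add' (fun k : ℕ => v (k + h) * u k) 0 n 1
    have h3 : Finset.Ico (0 + 1) (n + 1) = Finset.Icc 1 n := by ext; simp
    rw [h3] at h2
    rw [Finset.sum_sub_distrib, ← h2, Finset.range_eq_Ico]
    simp
  have h2 := Finset.sum_sdiff (f := fun k : ℕ => v (k + h) * u k)
    (Finset.Icc_subset_Icc_right (a := 1) (Nat.sub_le n h))
  have h3 : ∀ a b : ℝ, ∑ k ∈ Finset.Icc 1 (n - h), (u k - a) * (v (k + h) - b)
      = ∑ k ∈ Finset.Icc 1 (n - h), v (k + h) * u k - (∑ k ∈ Finset.Icc 1 (n - h), u k) * b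
        - a * ∑ k ∈ Finset.Icc 1 (n - h), v (k + h) + (n - h : ℕ) * (a * b) := by
    intro a b
    have h4 : ∀ k ∈ Finset.Icc 1 (n - h), (u k - a) * (v (k + h) - b)
        = v (k + h) * u k - u k * b - a * v (k + h) + a * b := fun k _ => by ring
    rw [Finset.sum_congr rfl h4, Finset.sum_add_distrib, Finset.sum_sub_distrib,
      Finset.sum_sub_distrib, ← Finset.sum_mul, ← Finset.mul_sum]
    simp
  rw [h1, h3, ← h2]
  have h5 : √(n : ℝ) = (√(n : ℝ))⁻¹ * n := by
    rw [eq_inv_mul_iff_mul_eq₀ hs.ne', Real.mul_self_sqrt hnr.le]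
  have h6 : √(n : ℝ) * (n : ℝ)⁻¹ = (√(n : ℝ))⁻¹ := by
    rw [← div_eq_mul_inv, Real.sqrt_div_self]
  rw [mul_sub, ← mul_assoc, h6]
  have h7 : √(n : ℝ) * g = (√(n : ℝ))⁻¹ * (n * g) := by rw [← mul_assoc, ← h5]
  rw [h7]
  ring

/-! ### The linear process and its sample autocovariances -/

section LinearProcess

variable {Ω : Type*} [MeasurableSpace Ω] {P : Measure Ω} [IsProbabilityMeasure P] {m : ℕ}
  {x y : ℤ → Ω → Fin m → ℝ} {C : ℤ → Matrix (Fin m) (Fin m) ℝ}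

namespace IsNoise

lemma hasSum_mul_pair {κ κ' : Type*} {f : κ → ℝ} {g : κ' → ℝ} {a b : ℝ} (hf : HasSum f a)
    (hg : HasSum g b) : HasSum (fun q : κ × κ' => f q.1 * g q.2) (a * b) :=
  hf.mul hg (summable_mul_pair hf.summable hg.summable)

/-- The inner product of `t` with `Y_{k+h} ⊗ Y_k`, as a series in `L²`. -/
noncomputable def quadLp (hx : IsNoise P x) (C : ℤ → Matrix (Fin m) (Fin m) ℝ) (h : ℤ)
    (t : Fin m × Fin m → ℝ) (k : ℤ) : Lp ℝ 2 P :=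
  ∑' q : ℤ × ℤ, ∑ p, bilinCoeff C h t q p • hx.prodLp (k - q.1) (k - q.2) p

lemma summable_quadLp (hx : IsNoise P x) (hC : ∀ α a, Summable fun j : ℤ => C j α a) (h : ℤ)
    (t : Fin m × Fin m → ℝ) (k : ℤ) : Summable fun q : ℤ × ℤ =>
      ∑ p, bilinCoeff C h t q p • hx.prodLp (k - q.1) (k - q.2) p := by
  obtain ⟨M, hM0, hM⟩ := hx.exists_norm_prodLp_le
  exact Summable.of_norm_bounded ((summable_bilinCoeff hC h t).mul_left M) fun q =>
    norm_sum_smul_le _ fun p => hM _ _ _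

lemma centre_quadLp (hx : IsNoise P x) (hC : ∀ α a, Summable fun j : ℤ => C j α a) (h : ℤ)
    (t : Fin m × Fin m → ℝ) (k : ℤ) : centre P (hx.quadLp C h t k) =
      ∑' q : ℤ × ℤ, ∑ p, bilinCoeff C h t q p • hx.cprodLp (k - q.1) (k - q.2) p := by
  rw [quadLp, (centre P).map_tsum (hx.summable_quadLp hC h t k)]
  simp only [map_sum, map_smul]
  rfl

lemma tsum_eq_tsum_diff {g : ℤ × ℤ → ℝ} (hg : Summable g) :
    ∑' q, g q = ∑' (δ : ℤ) (j : ℤ), g (j + δ, j) := by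
  have h1 : Summable fun q : ℤ × ℤ => g (q.2 + q.1, q.2) := diffEquiv.summable_iff.2 hg
  rw [← diffEquiv.tsum_eq g]
  exact h1.tsum_prod

/-- Only products at equal times have a mean, so only the diagonal δ = 0 contributes, whatever `k`.
-/
lemma integral_quadLp (hx : IsNoise P x) (hC : ∀ α a, Summable fun j : ℤ => C j α a) (h : ℤ)
    (t : Fin m × Fin m → ℝ) (k : ℤ) : ∫ ω, hx.quadLp C h t k ω ∂P =
      ∑ p, ((sigmaInt C h)ᵀ *ᵥ t) p * ∫ ω, x 1 ω p.1 * x 1 ω p.2 ∂P := by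
  have hs := hx.summable_quadLp hC h t k
  have h1 : ∫ ω, hx.quadLp C h t k ω ∂P = ∑' q : ℤ × ℤ, ∑ p, bilinCoeff C h t q p *
      (if q.1 = q.2 then ∫ ω, x 1 ω p.1 * x 1 ω p.2 ∂P else 0) := by
    rw [← inner_const_one, quadLp]
    refine ((innerSL ℝ (Lp.const 2 P (1 : ℝ))).map_tsum hs).trans (tsum_congr fun q => ?_)
    simp only [map_sum, map_smul, innerSL_apply_apply, inner_const_one, integral_prodLp,
      smul_eq_mul, sub_right_inj]
  have hs' : Summable fun q : ℤ × ℤ => ∑ p, bilinCoeff C h t q p *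
      (if q.1 = q.2 then ∫ ω, x 1 ω p.1 * x 1 ω p.2 ∂P else 0) := by
    refine (hs.mapL (innerSL ℝ (Lp.const 2 P (1 : ℝ)))).congr fun q => ?_
    simp only [map_sum, map_smul, innerSL_apply_apply, inner_const_one, integral_prodLp,
      smul_eq_mul, sub_right_inj]
  rw [h1, tsum_eq_tsum_diff hs', tsum_eq_single 0]
  · have h2 : ∀ p, Summable fun j : ℤ => bilinCoeff C h t (j, j) p := by
      intro p
      have h3 : Summable fun q => bilinCoeff C h t q p :=
        Summable.of_norm_bounded (summable_bilinCoeff hC h t) fun q =>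
          Finset.single_le_sum (f := fun p => |bilinCoeff C h t q p|) (fun _ _ => abs_nonneg _)
            (Finset.mem_univ p)
      exact h3.comp_injective (i := fun j : ℤ => (j, j)) fun _ _ hab => (Prod.ext_iff.1 hab).1
    simp only [add_zero, if_true]
    rw [Summable.tsum_finsetSum fun p _ => (h2 p).mul_right _]
    refine Finset.sum_congr rfl fun p _ => ?_
    rw [tsum_mul_right]
    congr 1
    simpa using tsum_bilinCoeff hC h 0 t p
  · intro δ hδ
    simp [hδ]

/-- The coordinate series converge unconditionally, hence absolutely, almost surely, so their
product is the double series; its L² sum is the same function a.e. -/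
lemma quadLp_coeFn (hx : IsNoise P x) (hC : ∀ α a, Summable fun j : ℤ => C j α a)
    (hy : ∀ k, ∀ᵐ ω ∂P, ∀ α, HasSum (fun j : ℤ => ∑ a, C j α a * x (k - j) ω a) (y k ω α)) (h : ℤ)
    (t : Fin m × Fin m → ℝ) (k : ℤ) :
    hx.quadLp C h t k =ᵐ[P] fun ω => ∑ r, t r * (y (k + h) ω r.1 * y k ω r.2) := by
  refine ae_eq_of_hasSum_Lp (hx.summable_quadLp hC h t k).hasSum
    (φ := fun q ω => ∑ p : Fin m × Fin m, bilinCoeff C h t q p *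
      (x (k - q.1) ω p.1 * x (k - q.2) ω p.2)) (fun q => ?_) ?_
  · have h1 : ∀ᵐ ω ∂P, ∀ p, (bilinCoeff C h t q p • hx.prodLp (k - q.1) (k - q.2) p : Lp ℝ 2 P) ω
        = bilinCoeff C h t q p * (x (k - q.1) ω p.1 * x (k - q.2) ω p.2) := by
      refine ae_all_iff.2 fun p => ?_
      filter_upwards [Lp.coeFn_smul (bilinCoeff C h t q p) (hx.prodLp (k - q.1) (k - q.2) p),
        hx.prodLp_coeFn (k - q.1) (k - q.2) p] with ω h2 h3
      rw [h2, Pi.smul_apply, h3, smul_eq_mul]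
    filter_upwards [Lp_coeFn_sum Finset.univ fun p =>
      bilinCoeff C h t q p • hx.prodLp (k - q.1) (k - q.2) p, h1] with ω h2 h3
    rw [h2]
    exact Finset.sum_congr rfl fun p _ => h3 p
  · filter_upwards [hy (k + h), hy k] with ω h1 h2
    have h3 : ∀ α, HasSum (fun j : ℤ => ∑ a, C (j + h) α a * x (k - j) ω a) (y (k + h) ω α) := by
      intro α
      have := ((Equiv.addRight h).hasSum_iff
        (f := fun j : ℤ => ∑ a, C j α a * x (k + h - j) ω a)).2 (h1 α)
      simpa only [Function.comp_def, Equiv.coe_addRight, add_sub_add_right_eq_sub] using this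
    have h4 : ∀ r : Fin m × Fin m, HasSum (fun q : ℤ × ℤ =>
        t r * ((∑ a, C (q.1 + h) r.1 a * x (k - q.1) ω a) * ∑ b, C q.2 r.2 b * x (k - q.2) ω b))
        (t r * (y (k + h) ω r.1 * y k ω r.2)) := fun r => by
      have h5 := hasSum_mul_pair (h3 r.1) (h2 r.2)
      exact h5.mul_left (t r)
    have h5 := hasSum_sum (s := Finset.univ) fun r _ => h4 r
    convert h5 using 1
    ext1 q
    simp only [bilinCoeff, Finset.sum_mul]
    rw [Finset.sum_comm]
    refine Finset.sum_congr rfl fun r _ => ?_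
    rw [← Finset.sum_mul, Finset.sum_mul_sum, Finset.mul_sum, Fintype.sum_prod_type]
    refine Finset.sum_congr rfl fun a _ => ?_
    rw [Finset.mul_sum]
    refine Finset.sum_congr rfl fun b _ => ?_
    ring

/-- A coordinate of the linear process, as a series in `L²`. -/
noncomputable def linLp (hx : IsNoise P x) (C : ℤ → Matrix (Fin m) (Fin m) ℝ) (k : ℤ) (α : Fin m) :
    Lp ℝ 2 P :=
  ∑' j : ℤ, ∑ a, C j α a • hx.coordLp (k - j) a

lemma summable_sum_abs (hC : ∀ α a, Summable fun j : ℤ => C j α a) (α : Fin m) :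
    Summable fun j : ℤ => ∑ a, |C j α a| := summable_sum fun a _ => (hC α a).abs

lemma summable_linLp (hx : IsNoise P x) (hC : ∀ α a, Summable fun j : ℤ => C j α a) (k : ℤ)
    (α : Fin m) : Summable fun j : ℤ => ∑ a, C j α a • hx.coordLp (k - j) a := by
  obtain ⟨M, hM0, hM⟩ := hx.exists_norm_coordLp_le
  exact Summable.of_norm_bounded ((summable_sum_abs hC α).mul_left M) fun q =>
    norm_sum_smul_le _ fun a => hM _ _

lemma linLp_coeFn (hx : IsNoise P x) (hC : ∀ α a, Summable fun j : ℤ => C j α a)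
    (hy : ∀ k, ∀ᵐ ω ∂P, ∀ α, HasSum (fun j : ℤ => ∑ a, C j α a * x (k - j) ω a) (y k ω α))
    (k : ℤ) (α : Fin m) : hx.linLp C k α =ᵐ[P] fun ω => y k ω α := by
  refine ae_eq_of_hasSum_Lp (hx.summable_linLp hC k α).hasSum
    (φ := fun j ω => ∑ a, C j α a * x (k - j) ω a) (fun j => ?_) ((hy k).mono fun ω h => h α)
  have h1 : ∀ᵐ ω ∂P, ∀ a, (C j α a • hx.coordLp (k - j) a : Lp ℝ 2 P) ω
      = C j α a * x (k - j) ω a := by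
    refine ae_all_iff.2 fun a => ?_
    filter_upwards [Lp.coeFn_smul (C j α a) (hx.coordLp (k - j) a),
      hx.coordLp_coeFn (k - j) a] with ω h2 h3
    rw [h2, Pi.smul_apply, h3, smul_eq_mul]
  filter_upwards [Lp_coeFn_sum Finset.univ fun a => C j α a • hx.coordLp (k - j) a, h1] with ω h2 h3
  rw [h2]
  exact Finset.sum_congr rfl fun a _ => h3 a

/-- Sums of `N` terms of the linear process are of order `√N` in `L²`. -/
lemma exists_norm_sum_linLp_le (hx : IsNoise P x) (hC : ∀ α a, Summable fun j : ℤ => C j α a) :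
    ∃ M : ℝ, 0 ≤ M ∧ ∀ (I : Finset ℕ) (e : ℤ) (α : Fin m),
      ‖∑ k ∈ I, hx.linLp C (k + e) α‖ ≤ M * √(I.card) := by
  obtain ⟨M, hM0, hM⟩ := hx.exists_norm_coordLp_le
  refine ⟨∑ α, ∑' j : ℤ, M * ∑ a, |C j α a|, by positivity, fun I e α => ?_⟩
  have h1 : ∀ (j : ℤ) a, ‖∑ k ∈ I, hx.coordLp (k + e - j) a‖ ≤ M * √(I.card) := fun j a =>
    norm_sum_le_of_orthogonal hM0 I (fun k _ l _ hkl => by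
      rw [inner_coordLp, if_neg (by simpa using hkl)]) fun k _ => hM _ _
  -- Interchanging the sums leaves, for each fixed coefficient index `j`, a sum of orthogonal noise
  -- coordinates.
  have h2 : ∑ k ∈ I, hx.linLp C (k + e) α
      = ∑' j : ℤ, ∑ a, C j α a • ∑ k ∈ I, hx.coordLp (k + e - j) a := by
    simp only [linLp]
    rw [← Summable.tsum_finsetSum fun k _ => hx.summable_linLp hC _ α]
    refine tsum_congr fun j => ?_
    rw [Finset.sum_comm]
    simp only [Finset.smul_sum]
  rw [h2]
  have h3 := tsum_of_norm_bounded
    (((summable_sum_abs hC α).mul_left (M * √(I.card))).hasSum) fun j =>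
      norm_sum_smul_le (fun a => C j α a) (f := fun a => ∑ k ∈ I, hx.coordLp (k + e - j) a) (h1 j)
  refine h3.trans ?_
  rw [tsum_mul_left, mul_right_comm, ← tsum_mul_left (a := M)]
  gcongr
  exact Finset.single_le_sum (f := fun α => ∑' j : ℤ, M * ∑ a, |C j α a|)
    (fun _ _ => by positivity) (Finset.mem_univ α)

/-- The central limit theorem for the lagged products of the linear process. -/
lemma tendsto_cfOne_lagged_products (hx : IsNoise P x)
    (hC : ∀ α a, Summable fun j : ℤ => C j α a)
    (hy : ∀ k, ∀ᵐ ω ∂P, ∀ α, HasSum (fun j : ℤ => ∑ a, C j α a * x (k - j) ω a) (y k ω α)) (h : ℤ)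
    (t : Fin m × Fin m → ℝ) :
    Tendsto (fun n : ℕ => cfOne P (fun ω => ∑ r, t r * ((√(n : ℝ))⁻¹ * ∑ k ∈ Finset.range n,
        (y (k + 1 + h) ω r.1 * y (k + 1) ω r.2 - ∫ ω, y h ω r.1 * y 0 ω r.2 ∂P))))
      atTop (𝓝 (Complex.exp (-((‖hx.limitLp C h t‖ ^ 2 / 2 : ℝ) : ℂ)))) := by
  have h1 := hx.tendsto_cfOne_bilinear (summable_bilinCoeff hC h t)
  simp only [tsum_bilinCoeff hC] at h1
  refine h1.congr fun n => cfOne_congr ?_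
  simp only [← hx.centre_quadLp hC]
  have hint : ∀ (k : ℤ) (r : Fin m × Fin m), Integrable (fun ω => y (k + h) ω r.1 * y k ω r.2) P := fun k r =>
    (L1Bound.mul _ _ (hx.linLp_coeFn hC hy (k + h) r.1) (hx.linLp_coeFn hC hy k r.2) le_rfl
      le_rfl).1
  have hmean : ∀ k, ∫ ω, hx.quadLp C h t k ω ∂P
      = ∑ r : Fin m × Fin m, t r * ∫ ω, y h ω r.1 * y 0 ω r.2 ∂P := by
    intro k
    rw [hx.integral_quadLp hC, ← hx.integral_quadLp hC h t 0,
      integral_congr_ae (hx.quadLp_coeFn hC hy h t 0),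
      integral_finsetSum _ fun r _ => (hint 0 r).const_mul _]
    simp only [integral_const_mul, zero_add]
  have h2 : ∀ᵐ ω ∂P, ∀ k : ℕ, centre P (hx.quadLp C h t (k + 1)) ω =
      ∑ r, t r * (y (k + 1 + h) ω r.1 * y (k + 1) ω r.2 - ∫ ω, y h ω r.1 * y 0 ω r.2 ∂P) := by
    refine ae_all_iff.2 fun k => ?_
    filter_upwards [centre_coeFn (hx.quadLp C h t (k + 1)), hx.quadLp_coeFn hC hy h t (k + 1)]
      with ω h3 h4
    rw [h3, h4, hmean, ← Finset.sum_sub_distrib]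
    simp only [mul_sub]
  filter_upwards [h2, Lp.coeFn_smul (√(n : ℝ))⁻¹
    (∑ k ∈ Finset.range n, centre P (hx.quadLp C h t (k + 1))),
    Lp_coeFn_sum (Finset.range n) fun k : ℕ => centre P (hx.quadLp C h t (k + 1))] with ω h3 h4 h5
  rw [h4, Pi.smul_apply, h5, smul_eq_mul]
  simp only [h3]
  rw [Finset.sum_comm, Finset.mul_sum]
  refine Finset.sum_congr rfl fun r _ => ?_
  rw [← Finset.mul_sum]
  ring

/-- Centring at the sample mean and truncating the sum do not affect the limit. -/
lemma exists_L1Bound_sampleAutocov (hx : IsNoise P x)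
    (hC : ∀ α a, Summable fun j : ℤ => C j α a)
    (hy : ∀ k, ∀ᵐ ω ∂P, ∀ α, HasSum (fun j : ℤ => ∑ a, C j α a * x (k - j) ω a) (y k ω α))
    (h : ℕ) : ∃ c : ℝ, ∀ (n : ℕ) (α β : Fin m) (g : ℝ), h ≤ n → 0 < n →
      L1Bound P (fun ω => √(n : ℝ) * ((n : ℝ)⁻¹ * ∑ k ∈ Finset.Icc 1 (n - h),
        (y k ω β - (n : ℝ)⁻¹ * ∑ k ∈ Finset.Icc 1 n, y k ω β)
          * (y (k + h) ω α - (n : ℝ)⁻¹ * ∑ k ∈ Finset.Icc 1 n, y k ω α) - g)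
      - (√(n : ℝ))⁻¹ * ∑ k ∈ Finset.range n, (y (k + 1 + h) ω α * y (k + 1) ω β - g))
      ((√(n : ℝ))⁻¹ * c) := by
  obtain ⟨M, hM0, hM⟩ := hx.exists_norm_sum_linLp_le hC
  -- Each of the three remainders containing a sample mean contributes at most M², and so does each
  -- of the at most `h` products missing at the end of the sum.
  refine ⟨M ^ 2 * (h + 3), fun n α β g hn hn0 => ?_⟩
  have hnr : (0 : ℝ) < n := by exact_mod_cast hn0
  have hae : ∀ (I : Finset ℕ) (e : ℤ) (α : Fin m), ((∑ k ∈ I, hx.linLp C (k + e) α : Lp ℝ 2 P) :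
      Ω → ℝ) =ᵐ[P] fun ω => ∑ k ∈ I, y (k + e) ω α := by
    intro I e α
    have h1 : ∀ᵐ ω ∂P, ∀ k : ℕ, hx.linLp C (k + e) α ω = y (k + e) ω α :=
      ae_all_iff.2 fun k => hx.linLp_coeFn hC hy _ _
    filter_upwards [Lp_coeFn_sum I fun k : ℕ => hx.linLp C (k + e) α, h1] with ω h2 h3
    rw [h2]
    exact Finset.sum_congr rfl fun k _ => h3 k
  have hnorm : ∀ (I : Finset ℕ) (e : ℤ) (α : Fin m), I.card ≤ n →
      ‖∑ k ∈ I, hx.linLp C (k + e) α‖ ≤ M * √(n : ℝ) := fun I e α hI =>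
    (hM I e α).trans (by gcongr)
  have hprod : ∀ (I J : Finset ℕ) (e e' : ℤ) (α β : Fin m), I.card ≤ n → J.card ≤ n →
      L1Bound P (fun ω => (∑ k ∈ I, y (k + e) ω β) * ∑ k ∈ J, y (k + e') ω α) (M ^ 2 * n) := by
    intro I J e e' α β hI hJ
    refine (L1Bound.mul _ _ (hae I e β) (hae J e' α) (hnorm I e β hI) (hnorm J e' α hJ)).mono
      (le_of_eq ?_)
    rw [mul_mul_mul_comm, Real.mul_self_sqrt hnr.le, pow_two]
  have hone : ∀ (k : ℤ) (α : Fin m), ‖hx.linLp C k α‖ ≤ M := by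
    intro k α
    simpa using hM {0} k α
  have hcard : (Finset.Icc 1 (n - h)).card ≤ n := by simp
  have hcard' : (Finset.Icc 1 n).card ≤ n := by simp
  have b1 := (hprod (Finset.Icc 1 n) (Finset.Icc 1 n) 0 0 α β hcard' hcard').const_mul
    ((n - h : ℕ) * (n : ℝ)⁻¹ * (n : ℝ)⁻¹)
  have b2 := (hprod (Finset.Icc 1 (n - h)) (Finset.Icc 1 n) 0 0 α β hcard hcard').const_mul
    (n : ℝ)⁻¹
  have b3 := (hprod (Finset.Icc 1 n) (Finset.Icc 1 (n - h)) 0 h α β hcard' hcard).const_mul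
    (n : ℝ)⁻¹
  have b4 := L1Bound.sum (s := Finset.Icc 1 n \ Finset.Icc 1 (n - h)) (P := P)
    (f := fun (k : ℕ) ω => y (k + h) ω α * y k ω β) (c := fun _ => M * M) fun k _ =>
      L1Bound.mul _ _ (hx.linLp_coeFn hC hy _ α) (hx.linLp_coeFn hC hy _ β) (hone _ _) (hone _ _)
  have b5 := (((b1.sub b2).sub b3).sub b4).const_mul (√(n : ℝ))⁻¹
  have hid := fun ω => sampleAutocov_sub_eq (fun k => y k ω β) (fun k => y k ω α) (h := h) hn0 g
  simp only [hid]
  simp only [add_zero] at b5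
  refine b5.mono ?_
  rw [abs_of_nonneg (by positivity : (0 : ℝ) ≤ (√(n : ℝ))⁻¹)]
  refine mul_le_mul_of_nonneg_left ?_ (by positivity)
  rw [abs_of_nonneg (by positivity), abs_of_nonneg (by positivity)]
  have hc : ((Finset.Icc 1 n \ Finset.Icc 1 (n - h)).card : ℝ) ≤ h := by
    rw [Finset.card_sdiff_of_subset (Finset.Icc_subset_Icc_right (Nat.sub_le n h))]
    simp only [Nat.card_Icc]
    exact_mod_cast (by omega : n + 1 - 1 - (n - h + 1 - 1) ≤ h)
  have hq : ((n - h : ℕ) : ℝ) * (n : ℝ)⁻¹ ≤ 1 := by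
    rw [mul_inv_le_iff₀ hnr, one_mul]
    exact_mod_cast Nat.sub_le n h
  rw [Finset.sum_const, nsmul_eq_mul]
  have hi : (n : ℝ)⁻¹ * (M ^ 2 * n) = M ^ 2 := by field_simp
  rw [mul_assoc _ (n : ℝ)⁻¹ (M ^ 2 * n), hi]
  nlinarith [mul_le_mul_of_nonneg_right hq (sq_nonneg M),
    mul_le_mul_of_nonneg_right hc (sq_nonneg M)]

end IsNoise

end LinearProcess


/-! ### From the given process to the limit theorem -/

section Assembly

variable {Ω : Type*} [MeasurableSpace Ω] {P : Measure Ω} [IsProbabilityMeasure P] {m : ℕ}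
  {C : ℤ → Matrix (Fin m) (Fin m) ℝ} {ξ Y : ℤ → Ω → EuclideanSpace ℝ (Fin m)}

/-- An iid centred sequence with finite fourth moments has a measurable version. -/
lemma exists_isNoise (hindep : iIndepFun ξ P) (hident : ∀ k, IdentDistrib (ξ k) (ξ 1) P P)
    (hmom : MemLp (ξ 1) 4 P) (hmean : ∫ ω, ξ 1 ω ∂P = 0) :
    ∃ x : ℤ → Ω → Fin m → ℝ, IsNoise P x ∧ ∀ k, ∀ᵐ ω ∂P, x k ω = (ξ k ω).ofLp := by
  have hae : ∀ k, AEMeasurable (ξ k) P := fun k => (hident k).aemeasurable_fst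
  have hofLp : Measurable fun v : EuclideanSpace ℝ (Fin m) => v.ofLp :=
    WithLp.measurable_ofLp 2 _
  have hcoord : ∀ a : Fin m, Measurable fun v : EuclideanSpace ℝ (Fin m) => v.ofLp a :=
    fun a => (measurable_pi_apply a).comp hofLp
  have hae' : ∀ k, ∀ᵐ ω ∂P, ((hae k).mk (ξ k) ω).ofLp = (ξ k ω).ofLp := fun k =>
    (hae k).ae_eq_mk.mono fun ω h => by rw [h]
  have hid : ∀ k, IdentDistrib ((hae k).mk (ξ k)) (ξ 1) P P := fun k =>
    (IdentDistrib.of_ae_eq (hae k) (hae k).ae_eq_mk).symm.trans (hident k)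
  refine ⟨fun k ω => ((hae k).mk (ξ k) ω).ofLp, ⟨fun k => hofLp.comp (hae k).measurable_mk, ?_,
    fun k l => ((hid k).trans (hid l).symm).comp hofLp, fun k a => ?_, fun k a => ?_⟩, hae'⟩
  · exact (hindep.congr fun k => (hae k).ae_eq_mk).comp (fun _ v => v.ofLp) fun _ => hofLp
  · have h1 : MemLp (fun ω => (ξ 1 ω).ofLp a) 4 P :=
      (EuclideanSpace.proj a : EuclideanSpace ℝ (Fin m) →L[ℝ] ℝ).comp_memLp' hmom
    exact ((hid k).comp (hcoord a)).memLp_iff.2 h1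
  · have h1 : ∫ ω, (ξ 1 ω).ofLp a ∂P = 0 := by
      have h2 := (EuclideanSpace.proj a : EuclideanSpace ℝ (Fin m) →L[ℝ] ℝ).integral_comp_comm
        (hmom.integrable (by norm_num))
      rw [hmean, map_zero] at h2
      exact h2
    exact ((hid k).comp (hcoord a)).integral_eq.trans h1

lemma hasSum_coord (hCneg : ∀ j : ℤ, j < 0 → C j = 0) (hY : IsMAProcess P C ξ Y)
    {x : ℤ → Ω → Fin m → ℝ} (hx : ∀ k, ∀ᵐ ω ∂P, x k ω = (ξ k ω).ofLp) (k : ℤ) :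
    ∀ᵐ ω ∂P, ∀ α, HasSum (fun j : ℤ => ∑ a, C j α a * x (k - j) ω a) ((Y k ω).ofLp α) := by
  filter_upwards [hY k, ae_all_iff.2 hx] with ω h1 h2 α
  have h3 : HasSum (fun j : ℕ => (Matrix.toEuclideanCLM (n := Fin m) (𝕜 := ℝ) (C j)
      (ξ (k - j) ω)).ofLp α) ((Y k ω).ofLp α) :=
    h1.mapL (EuclideanSpace.proj α : EuclideanSpace ℝ (Fin m) →L[ℝ] ℝ)
  simp only [Matrix.ofLp_toEuclideanCLM, Matrix.mulVec, dotProduct, ← h2] at h3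
  refine (Function.Injective.hasSum_iff (g := fun j : ℕ => (j : ℤ)) Nat.cast_injective
    fun j hj => ?_).1 h3
  have : C j = 0 := by_contra fun h => hj (natCast_range_of_ne_zero hCneg h)
  simp [this]

lemma sampleAutocov_apply (n h : ℕ) (ω : Ω) (α β : Fin m) :
    sampleAutocov Y n h ω β α = (n : ℝ)⁻¹ * ∑ k ∈ Finset.Icc 1 (n - h),
      ((Y k ω).ofLp β - (n : ℝ)⁻¹ * ∑ k ∈ Finset.Icc 1 n, (Y k ω).ofLp β)
        * ((Y (k + h) ω).ofLp α - (n : ℝ)⁻¹ * ∑ k ∈ Finset.Icc 1 n, (Y k ω).ofLp α) := by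
  simp [sampleAutocov, sampleMean, Matrix.sum_apply, Matrix.vecMulVec_apply]

/-- The mean of the lagged products, in terms of the coefficients. -/
lemma integral_lagged_product {x y : ℤ → Ω → Fin m → ℝ} (hx : IsNoise P x)
    (hCneg : ∀ j : ℤ, j < 0 → C j = 0) (hC : ∀ α a, Summable fun j : ℤ => C j α a)
    (hy : ∀ k, ∀ᵐ ω ∂P, ∀ α, HasSum (fun j : ℤ => ∑ a, C j α a * x (k - j) ω a) (y k ω α)) (h : ℤ)
    (r : Fin m × Fin m) {S : Matrix (Fin m) (Fin m) ℝ}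
    (hS : ∀ a b, S a b = ∫ ω, x 1 ω a * x 1 ω b ∂P) :
    ∫ ω, y h ω r.1 * y 0 ω r.2 ∂P = (sigmaSum C h *ᵥ S.vec) r := by
  -- A unit vector as test vector extracts the coordinate `r`.
  have h1 := hx.integral_quadLp hC h (Pi.single r 1) 0
  rw [integral_congr_ae (hx.quadLp_coeFn hC hy h (Pi.single r 1) 0)] at h1
  simp only [Pi.single_apply, ite_mul, one_mul, zero_mul, Finset.sum_ite_eq', Finset.mem_univ,
    if_true, zero_add, Matrix.mulVec_single_one] at h1
  rw [h1, sigmaSum_eq hCneg]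
  refine Finset.sum_congr rfl fun p _ => ?_
  simp only [Matrix.vec, hS, mul_comm (x 1 _ p.2)]
  rfl

/-- Asymptotic normality of the sample autocovariances, in terms of characteristic functions. -/
lemma tendsto_cfOne_sampleAutocov {x : ℤ → Ω → Fin m → ℝ} (hx : IsNoise P x)
    (hC : ∀ α a, Summable fun j : ℤ => C j α a)
    (hy : ∀ k, ∀ᵐ ω ∂P, ∀ α,
      HasSum (fun j : ℤ => ∑ a, C j α a * x (k - j) ω a) ((Y k ω).ofLp α))
    (h : ℕ) (hm : ∀ n α β, AEMeasurable (fun ω => sampleAutocov Y n h ω β α) P)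
    (t : Fin m × Fin m → ℝ) :
    Tendsto (fun n : ℕ => cfOne P (fun ω => ∑ r : Fin m × Fin m,
        t r * (√(n : ℝ) * (sampleAutocov Y n h ω r.2 r.1 - autocov P Y h r.2 r.1))))
      atTop (𝓝 (Complex.exp (-((‖hx.limitLp C h t‖ ^ 2 / 2 : ℝ) : ℂ)))) := by
  have h1 := hx.tendsto_cfOne_lagged_products (y := fun k ω => (Y k ω).ofLp) hC hy h t
  obtain ⟨c, hc⟩ := hx.exists_L1Bound_sampleAutocov (y := fun k ω => (Y k ω).ofLp) hC hy h
  have hYm : ∀ k α, AEMeasurable (fun ω => (Y k ω).ofLp α) P := fun k α =>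
    (Lp.aestronglyMeasurable _).aemeasurable.congr
      (hx.linLp_coeFn (y := fun k ω => (Y k ω).ofLp) hC hy k α)
  have hauto : ∀ r : Fin m × Fin m, autocov P Y h r.2 r.1
      = ∫ ω, (Y h ω).ofLp r.1 * (Y 0 ω).ofLp r.2 ∂P := fun r => by
    simp only [autocov, mixedMoment, Matrix.of_apply, mul_comm]
  rw [tendsto_iff_norm_sub_tendsto_zero] at h1 ⊢
  have hlim : Tendsto (fun n : ℕ => (√(n : ℝ))⁻¹ * ∑ r, |t r| * c) atTop (𝓝 0) :=
    tendsto_const_mul_inv_sqrt _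
  have hlim' := hlim.add h1
  rw [add_zero] at hlim'
  -- Triangle inequality through the sums of lagged products: the L¹ remainder controls the first
  -- distance, the limit theorem for those sums the second.
  refine squeeze_zero' (Eventually.of_forall fun _ => norm_nonneg _) ?_ hlim'
  filter_upwards [eventually_ge_atTop h, eventually_gt_atTop 0] with n hn hn0
  refine (norm_sub_le_norm_sub_add_norm_sub _ _ _).trans (add_le_add_left ?_ _)
  have hb := L1Bound.sum (s := Finset.univ) fun (r : Fin m × Fin m) _ =>
    (hc n r.1 r.2 (autocov P Y h r.2 r.1) hn hn0).const_mul (t r)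
  simp only [← sampleAutocov_apply] at hb
  have hb' : L1Bound P (fun ω => (∑ r : Fin m × Fin m,
        t r * (√(n : ℝ) * (sampleAutocov Y n h ω r.2 r.1 - autocov P Y h r.2 r.1)))
      - ∑ r : Fin m × Fin m, t r * ((√(n : ℝ))⁻¹ * ∑ k ∈ Finset.range n,
        ((Y (k + 1 + h) ω).ofLp r.1 * (Y (k + 1) ω).ofLp r.2
          - ∫ ω, (Y h ω).ofLp r.1 * (Y 0 ω).ofLp r.2 ∂P)))
      (∑ r, |t r| * ((√(n : ℝ))⁻¹ * c)) := by
    simpa only [← Finset.sum_sub_distrib, ← mul_sub, ← hauto] using hb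
  have hYY : ∀ (k : ℤ) (r : Fin m × Fin m), AEMeasurable
      (fun ω => (Y (k + h) ω).ofLp r.1 * (Y k ω).ofLp r.2
        - ∫ ω, (Y h ω).ofLp r.1 * (Y 0 ω).ofLp r.2 ∂P) P := fun k r =>
    ((hYm (k + h) r.1).mul (hYm k r.2)).sub_const _
  refine (norm_cfOne_sub_le ?_ ?_ hb'.1).trans (hb'.2.trans (le_of_eq ?_))
  · exact Finset.aemeasurable_fun_sum _ fun r _ =>
      (((hm n r.1 r.2).sub_const _).const_mul _).const_mul _
  · exact Finset.aemeasurable_fun_sum _ fun r _ => ((Finset.aemeasurable_fun_sum _ fun k _ =>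
      hYY _ r).const_mul _).const_mul _
  · rw [Finset.mul_sum]
    exact Finset.sum_congr rfl fun r _ => by ring

end Assembly

end MovingAverage

theorem corollary5p3 {Ω : Type*} [MeasurableSpace Ω] (P : Measure Ω) [IsProbabilityMeasure P]
    (m : ℕ) (C : ℤ → Matrix (Fin m) (Fin m) ℝ) (ξ Y : ℤ → Ω → EuclideanSpace ℝ (Fin m))
    -- the noise is iid, centred, with finite fourth moment
    (hindep : iIndepFun ξ P) (hident : ∀ k, IdentDistrib (ξ k) (ξ 1) P P)
    (hmom : MemLp (ξ 1) 4 P) (hmean : ∫ ω, ξ 1 ω ∂P = 0)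
    -- the coefficients
    (hCneg : ∀ j : ℤ, j < 0 → C j = 0)
    (hCsq : Summable fun j : ℕ => (j : ℝ) * MovingAverage.opNorm (C j) ^ 2)
    (hCabs : Summable fun j : ℕ => MovingAverage.opNorm (C j))
    (hY : MovingAverage.IsMAProcess P C ξ Y)
    -- the noise covariance and a root of it
    (S A : Matrix (Fin m) (Fin m) ℝ)
    (hS : S = MovingAverage.mixedMoment P (fun ω => (ξ 1 ω).ofLp) (fun ω => (ξ 1 ω).ofLp))
    (hA : S = A * Aᵀ) (h : ℕ) :
    -- all series involved converge
    (∀ r : ℤ, Summable fun j : ℕ => C (j + r) ⊗ₖ C j) ∧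
    (∀ r : ℤ, Summable fun j : ℕ => C j ⊗ₖ C (j + r)) ∧
    (Summable fun r : ℕ => MovingAverage.diagTerm C S h (r + 1)) ∧
    (Summable fun r : ℕ => MovingAverage.crossTerm C A h (r + 1)) ∧
    -- the autocovariance
    Integrable (fun ω => (Matrix.vecMulVec (Y 0 ω).ofLp (Y h ω).ofLp).vec) P ∧
    ∫ ω, (Matrix.vecMulVec (Y 0 ω).ofLp (Y h ω).ofLp).vec ∂P
      = ∫ ω, MovingAverage.kronVec (Y h ω).ofLp (Y 0 ω).ofLp ∂P ∧
    ∫ ω, MovingAverage.kronVec (Y h ω).ofLp (Y 0 ω).ofLp ∂P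
      = MovingAverage.sigmaSum C h *ᵥ S.vec ∧
    -- the limit matrix is a covariance matrix, and asymptotic normality holds
    (MovingAverage.limitCov C (MovingAverage.upsilonStar P (ξ 1)) S A h).PosSemidef ∧
    TendstoInDistribution
      (fun (n : ℕ) ω => WithLp.toLp 2
        (√(n : ℝ) • (MovingAverage.sampleAutocov Y n h ω - MovingAverage.autocov P Y h).vec))
      atTop (id : EuclideanSpace ℝ (Fin m × Fin m) → EuclideanSpace ℝ (Fin m × Fin m))
      (fun _ => P)
      (multivariateGaussian 0
        (MovingAverage.limitCov C (MovingAverage.upsilonStar P (ξ 1)) S A h)) := by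
  open MovingAverage in
  obtain ⟨x, hx, hxξ⟩ := exists_isNoise hindep hident hmom hmean
  have hC := summable_entry hCneg hCabs
  have hy := hasSum_coord hCneg hY hxξ
  have hS' : ∀ a b, S a b = ∫ ω, x 1 ω a * x 1 ω b ∂P := fun a b => by
    rw [hS]
    exact integral_congr_ae ((hxξ 1).mono fun ω hω => by simp only [hω])
  set U := upsilonStar P (ξ 1) with hUdef
  have hU : ∀ p p', U p p' = ∫ ω, (x 1 ω p.1 * x 1 ω p.2) * (x 1 ω p'.1 * x 1 ω p'.2) ∂P
      - (∫ ω, x 1 ω p.1 * x 1 ω p.2 ∂P) * ∫ ω, x 1 ω p'.1 * x 1 ω p'.2 ∂P := fun p p' => by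
    have h1 : ∀ p : Fin m × Fin m, ∫ ω, kronVec (ξ 1 ω).ofLp (ξ 1 ω).ofLp p ∂P
        = ∫ ω, x 1 ω p.1 * x 1 ω p.2 ∂P := fun p =>
      integral_congr_ae ((hxξ 1).mono fun ω hω => by simp only [hω, kronVec])
    have h2 : ∫ ω, kronVec (ξ 1 ω).ofLp (ξ 1 ω).ofLp p * kronVec (ξ 1 ω).ofLp (ξ 1 ω).ofLp p' ∂P
        = ∫ ω, (x 1 ω p.1 * x 1 ω p.2) * (x 1 ω p'.1 * x 1 ω p'.2) ∂P :=
      integral_congr_ae ((hxξ 1).mono fun ω hω => by simp only [hω, kronVec])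
    simp only [hUdef, upsilonStar, mixedMoment, Matrix.sub_apply, Matrix.of_apply,
      Matrix.vecMulVec_apply, h1, h2]
  have hUt : Uᵀ = U := by
    ext p p'
    rw [Matrix.transpose_apply, hU, hU, mul_comm (∫ ω, x 1 ω p'.1 * x 1 ω p'.2 ∂P)]
    simp only [mul_comm (x 1 _ p'.1 * x 1 _ p'.2)]
  have hvar := hx.norm_sq_limitLp hCneg hC U S A hU hS' hA h
  have hpsd : (limitCov C U S A h).PosSemidef := by
    refine Matrix.PosSemidef.of_dotProduct_mulVec_nonneg ?_ fun t => ?_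
    · rw [Matrix.IsHermitian, Matrix.conjTranspose_eq_transpose_of_trivial]
      exact limitCov_transpose hUt hA h
    · rw [star_trivial, ← hvar]
      positivity
  have hprod : ∀ r : Fin m × Fin m,
      Integrable (fun ω => (Y h ω).ofLp r.1 * (Y 0 ω).ofLp r.2) P := fun r =>
    (L1Bound.mul _ _ (hx.linLp_coeFn (y := fun k ω => (Y k ω).ofLp) hC hy h r.1)
      (hx.linLp_coeFn (y := fun k ω => (Y k ω).ofLp) hC hy 0 r.2) le_rfl le_rfl).1
  -- `Matrix.vec` is indexed by (column, row), so the first index belongs to Y_h; hence the order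
  -- `r.2 r.1` in matrix entries elsewhere.
  have hvec : (fun ω => (Matrix.vecMulVec (Y 0 ω).ofLp (Y h ω).ofLp).vec)
      = fun ω => kronVec (Y h ω).ofLp (Y 0 ω).ofLp := by
    ext ω p
    simp [Matrix.vec, Matrix.vecMulVec_apply, kronVec, mul_comm]
  have hkron : ∀ r : Fin m × Fin m,
      Integrable (fun ω => kronVec (Y h ω).ofLp (Y 0 ω).ofLp r) P := hprod
  have hYm : ∀ k α, AEMeasurable (fun ω => (Y k ω).ofLp α) P := fun k α =>
    (Lp.aestronglyMeasurable _).aemeasurable.congr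
      (hx.linLp_coeFn (y := fun k ω => (Y k ω).ofLp) hC hy k α)
  have hm : ∀ n α β, AEMeasurable (fun ω => sampleAutocov Y n h ω β α) P := fun n α β => by
    simp only [sampleAutocov_apply]
    have h1 : ∀ α, AEMeasurable
        (fun ω => (n : ℝ)⁻¹ * ∑ k ∈ Finset.Icc 1 n, (Y (k : ℕ) ω).ofLp α) P := fun α =>
      (Finset.aemeasurable_fun_sum _ fun k _ => hYm _ _).const_mul _
    have h2 : ∀ k α, AEMeasurable (fun ω => (Y k ω).ofLp α
        - (n : ℝ)⁻¹ * ∑ k ∈ Finset.Icc 1 n, (Y (k : ℕ) ω).ofLp α) P := fun k α =>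
      (hYm k α).sub (h1 α)
    exact (Finset.aemeasurable_fun_sum _ fun k _ => (h2 _ β).mul (h2 _ α)).const_mul _
  refine ⟨summable_sigmaSum_kron hC, summable_sigmaStarSum_kron hC,
    summable_diagTerm hCneg hC S h, summable_crossTerm hCneg hC A h, ?_, by rw [hvec], ?_, hpsd, ?_⟩
  · rw [hvec]
    exact Integrable.of_eval hkron
  · ext r
    rw [eval_integral hkron]
    exact integral_lagged_product (y := fun k ω => (Y k ω).ofLp) hx hCneg hC hy h r hS'
  · have hmeas : ∀ n : ℕ, AEMeasurable (fun ω => (WithLp.toLp 2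
        (√(n : ℝ) • (sampleAutocov Y n h ω - autocov P Y h).vec) :
          EuclideanSpace ℝ (Fin m × Fin m))) P := fun n => by
      refine (WithLp.measurable_toLp 2 _).comp_aemeasurable (aemeasurable_pi_iff.2 fun r => ?_)
      exact ((hm n r.1 r.2).sub_const _).const_mul _
    -- Lévy's continuity theorem: at `t`, the characteristic function is `cfOne` of the inner
    -- product with `t`.
    refine ⟨hmeas, by fun_prop, ProbabilityMeasure.tendsto_iff_tendsto_charFun.2 fun t => ?_⟩
    have h1 := tendsto_cfOne_sampleAutocov hx hC hy h hm t.ofLp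
    simp only [ProbabilityMeasure.coe_mk, Measure.map_id, charFun_multivariateGaussian hpsd]
    rw [hvar] at h1
    refine (h1.congr fun n => ?_).trans (le_of_eq ?_)
    · rw [charFun_apply, integral_map (hmeas n) (by fun_prop)]
      refine integral_congr_ae (Eventually.of_forall fun ω => ?_)
      simp only [PiLp.inner_apply, Pi.smul_apply, Matrix.vec, Matrix.sub_apply, smul_eq_mul]
      rfl
    · congr 2
      rw [inner_zero_right]
      push_cast
      ring
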